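/- Let $V:\mathbb R\to\mathbb R$ be smooth, let $T>0$ and $\gamma>0$, and suppose that $\int_{\mathbb R} e^{-V(r)/T}\,dr<\infty$ and $\int_{\mathbb R} V'(r)^2e^{-V(r)/T}\,dr<\infty$. On configurations $\omega=(r_x,p_x)_{x\in\mathbb Z}\in(\mathbb R\times\mathbb R)^{\mathbb Z}$ let $\mu=\mu_{0,T}$ be the zero-pressure Gibbs measure: all coordinates are independent, each $r_x$ has density proportional to $e^{-V(r)/T}$ and each $p_x$ is a centered Gaussian of variance $T$. Let $(\theta_x g)(\omega)=g(\theta_x\omega)$, $(\theta_x\omega)_z=\omega_{x+z}$, denote the shifts, and let $\mathcal H$ be the Hilbert space obtained by completing the $\mu$-square-integrable local functions (functions of finitely many coordinates) with respect to the semi-inner product $$\ll f,g\gg\;=\;\sum_{x\in\mathbb Z}\bigl\{\mu(f\,\theta_x g)-\mu(f)\mu(g)\bigr\}.$$ For $f$ in the vector space $C^1_0(\Omega)$ spanned by compactly supported $C^1$ functions of finitely many coordinates, put $\mathfrak L f=\mathfrak A f+\gamma\,\mathfrak S f$ with $$\mathfrak A f=\sum_{x\in\mathbb Z}\bigl[(p_x-p_{x-1})\,\partial_{r_x}f+(V'(r_{x+1})-V'(r_x))\,\partial_{p_x}f\bigr],\qquad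 (\mathfrak S f)(\omega)=\sum_{x\in\mathbb Z}\bigl[f(\omega^x)-f(\omega)\bigr],$$ where $\omega^x$ is $\omega$ with $p_x$ replaced by $-p_x$. Assume, as a standing assumption on the dynamics, that $\mathfrak L$ generates a strongly continuous semigroup on $\mathcal H$ with core $C_0^1(\Omega)$; that is, there is a strongly continuous semigroup of bounded operators on $\mathcal H$ whose infinitesimal generator (again denoted $\mathfrak L$) extends $\mathfrak L$ on $C^1_0(\Omega)$, and $C_0^1(\Omega)$ is dense in the domain of the generator for the graph norm. Let $j_{0,1}=-p_0V'(r_1)\in\mathcal H$ be the energy current. Then, for every $\lambda>0$, $\lambda-\mathfrak L$ is a bijection from the domain of $\mathfrak L$ onto $\mathcal H$; the Green–Kubo conductivity at zero pressure $$\kappa(T)=\frac1{T^2}\lim_{\lambda\to0^+}\ll j_{0,1},(\lambda-\mathfrak L)^{-1}j_{0,1}\gg$$ exists as a finite limit; and $$\kappa(T)\;\le\;\frac{1}{4\gamma T}\,\mathrm{Var}\bigl(V'(r_0)\bigr),$$ where $\mathrm{Var}$ is the variance with respect to $\mu_{0,T}$. -/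

import Mathlib

open MeasureTheory ProbabilityTheory Filter Topology
open scoped NNReal

noncomputable section

/-! ## Configurations, local functions, and the space-time fluctuation inner product -/

/-- Configurations of the infinite chain: `(ω x).1` is the interparticle distance `r_x` and
`(ω x).2` is the momentum `p_x`. -/
abbrev Config : Type := ℤ → ℝ × ℝ

/-- The shift: `(shift x ω)_z = ω_{x+z}`. -/
def shift (x : ℤ) (ω : Config) : Config := fun z => ω (x + z)

/-- The configuration `ω^x`: the momentum of particle `x` is reversed. -/
def flipAt (x : ℤ) (ω : Config) : Config := Function.update ω x ((ω x).1, -(ω x).2)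

/-- The infinite product measure with one-site marginal `ν`. -/
def chainMeasure (ν : Measure (ℝ × ℝ)) : Measure Config := Measure.infinitePi fun _ : ℤ => ν

/-- A function of the configuration is local if it depends on finitely many sites only. -/
def IsLocal (f : Config → ℝ) : Prop := ∃ Λ : Finset ℤ, DependsOn f (Λ : Set ℤ)

/-- The vector space of (measurable) square integrable local functions. -/
def localSubmodule (ν : Measure (ℝ × ℝ)) : Submodule ℝ (Config → ℝ) where
  carrier := {f | IsLocal f ∧ Measurable f ∧ MemLp f 2 (chainMeasure ν)}
  zero_mem' := ⟨⟨∅, fun _ _ _ => rfl⟩, measurable_zero, MemLp.zero⟩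
  add_mem' := by
    rintro f g ⟨⟨Λ, hΛ⟩, hf, hf2⟩ ⟨⟨Λ', hΛ'⟩, hg, hg2⟩
    refine ⟨⟨Λ ∪ Λ', fun a b h => ?_⟩, hf.add hg, hf2.add hg2⟩
    have h1 := hΛ (x := a) (y := b) fun i hi => h i (by simp at hi ⊢; exact Or.inl hi)
    have h2 := hΛ' (x := a) (y := b) fun i hi => h i (by simp at hi ⊢; exact Or.inr hi)
    simp [h1, h2]
  smul_mem' := by
    rintro c f ⟨⟨Λ, hΛ⟩, hf, hf2⟩
    refine ⟨⟨Λ, fun a b h => ?_⟩, hf.const_smul c, hf2.const_smul c⟩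
    simp [hΛ h]

/-- The semi-inner product
`≪f, g≫ = ∑_{x ∈ ℤ} (μ(f · θ_x g) - μ(f) μ(g))`, where `(θ_x g)(ω) = g(θ_x ω)`.
For local functions only finitely many terms are nonzero. -/
def fluct (ν : Measure (ℝ × ℝ)) (f g : Config → ℝ) : ℝ :=
  ∑ᶠ x : ℤ, ((∫ ω, f ω * g (shift x ω) ∂chainMeasure ν)
    - (∫ ω, f ω ∂chainMeasure ν) * ∫ ω, g ω ∂chainMeasure ν)

section FluctFacts

variable (ν : Measure (ℝ × ℝ)) [IsProbabilityMeasure ν]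

instance : IsProbabilityMeasure (chainMeasure ν) := by
  unfold chainMeasure; infer_instance

theorem measurePreserving_shift (x : ℤ) :
    MeasurePreserving (shift x) (chainMeasure ν) (chainMeasure ν) := by
  have hm : Measurable (shift x) := measurable_pi_iff.2 fun z => measurable_pi_apply _
  refine ⟨hm, ?_⟩
  unfold chainMeasure
  apply Measure.eq_infinitePi
  intro s (t : ℤ → Set (ℝ × ℝ)) ht
  have e (i : ℤ) : t (x + i - x) = t i := by rw [add_sub_cancel_left]
  rw [Measure.map_apply hm (MeasurableSet.pi s.countable_toSet fun i _ => ht i)]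
  have : shift x ⁻¹' (Set.pi (s : Set ℤ) t) =
      Set.pi ((s.map (addLeftEmbedding x) : Finset ℤ) : Set ℤ) (fun i => t (i - x)) := by
    ext ω
    simp only [shift, Set.mem_preimage, Set.mem_pi, Finset.mem_coe, Finset.mem_map]
    constructor
    · rintro h i ⟨j, hj, rfl⟩
      simpa [addLeftEmbedding, e] using h j hj
    · intro h i hi
      simpa [e] using h (x + i) ⟨i, hi, rfl⟩
  rw [this, Measure.infinitePi_pi _ (fun i _ => ht _)]
  rw [Finset.prod_map]
  refine Finset.prod_congr rfl fun i _ => ?_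
  simp [addLeftEmbedding]

variable {ν}

theorem indepFun_of_dependsOn {f g : Config → ℝ} (hf : Measurable f) (hg : Measurable g)
    {S T : Finset ℤ} (hfS : DependsOn f (S : Set ℤ)) (hgT : DependsOn g (T : Set ℤ))
    (hST : Disjoint S T) : IndepFun f g (chainMeasure ν) := by
  have hind : iIndepFun (fun (i : ℤ) (ω : Config) => ω i) (chainMeasure ν) :=
    iIndepFun_infinitePi (P := fun _ : ℤ => ν) (X := fun _ (y : ℝ × ℝ) => y)
      (fun _ => measurable_id)
  have h := hind.indepFun_finset S T hST (fun i => measurable_pi_apply i)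
  let ext (S : Finset ℤ) (y : S → ℝ × ℝ) : Config := fun i => if hi : i ∈ S then y ⟨i, hi⟩ else 0
  have hext (S : Finset ℤ) : Measurable (ext S) := by
    refine measurable_pi_iff.2 fun i => ?_
    by_cases hi : i ∈ S
    · simpa [ext, hi] using measurable_pi_apply _
    · simp [ext, hi]
  have h' := h.comp (hf.comp (hext S)) (hg.comp (hext T))
  convert h' using 1
  · ext ω
    exact hfS fun i hi => by simp [ext, Finset.mem_coe.1 hi]
  · ext ω
    exact hgT fun i hi => by simp [ext, Finset.mem_coe.1 hi]

theorem memLp_shift {f : Config → ℝ} (hf : f ∈ localSubmodule ν) (x : ℤ) :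
    MemLp (fun ω => f (shift x ω)) 2 (chainMeasure ν) :=
  hf.2.2.comp_measurePreserving (measurePreserving_shift ν x)

theorem integral_shift {f : Config → ℝ} (hf : Measurable f) (x : ℤ) :
    ∫ ω, f (shift x ω) ∂chainMeasure ν = ∫ ω, f ω ∂chainMeasure ν := by
  have h := measurePreserving_shift ν x
  conv_rhs => rw [← h.map_eq]
  rw [integral_map h.measurable.aemeasurable hf.aestronglyMeasurable]

theorem measurable_shift (x : ℤ) : Measurable (shift x) :=
  measurable_pi_iff.2 fun _ => measurable_pi_apply _

theorem fluctTerm_eq_cov {f g : Config → ℝ} (hf : f ∈ localSubmodule ν)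
    (hg : g ∈ localSubmodule ν) (x : ℤ) :
    (∫ ω, f ω * g (shift x ω) ∂chainMeasure ν)
      - (∫ ω, f ω ∂chainMeasure ν) * ∫ ω, g ω ∂chainMeasure ν
    = cov[f, fun ω => g (shift x ω); chainMeasure ν] := by
  rw [covariance_eq_sub hf.2.2 (memLp_shift hg x), integral_shift hg.2.1]
  rfl

theorem fluct_eq_cov {f g : Config → ℝ} (hf : f ∈ localSubmodule ν)
    (hg : g ∈ localSubmodule ν) :
    fluct ν f g = ∑ᶠ x : ℤ, cov[f, fun ω => g (shift x ω); chainMeasure ν] :=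
  finsum_congr fun x => fluctTerm_eq_cov hf hg x

theorem finite_support_cov {f g : Config → ℝ} (hf : f ∈ localSubmodule ν)
    (hg : g ∈ localSubmodule ν) :
    (Function.support fun x : ℤ => cov[f, fun ω => g (shift x ω); chainMeasure ν]).Finite := by
  obtain ⟨⟨S, hS⟩, hfm, hf2⟩ := hf
  obtain ⟨⟨T, hT⟩, hgm, hg2⟩ := id hg
  refine ((S ×ˢ T).image fun q => q.1 - q.2).finite_toSet.subset fun x hx => ?_
  by_contra hcon
  apply hx
  have hdep : DependsOn (fun ω => g (shift x ω))
      ((T.map (addLeftEmbedding x) : Finset ℤ) : Set ℤ) := by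
    intro a b h
    exact hT fun i hi => h (x + i) (by simpa using hi)
  refine (indepFun_of_dependsOn hfm (hgm.comp (measurable_shift x)) hS hdep ?_).covariance_eq_zero
    hf2 (memLp_shift hg x)
  rw [Finset.disjoint_left]
  intro i hi hi'
  obtain ⟨j, hj, rfl⟩ := Finset.mem_map.1 hi'
  refine hcon (Finset.mem_coe.2 (Finset.mem_image.2 ⟨(_, j), Finset.mem_product.2 ⟨hi, hj⟩, ?_⟩))
  simp [addLeftEmbedding]

theorem cov_shift_shift {f g : Config → ℝ} (hf : f ∈ localSubmodule ν)
    (hg : g ∈ localSubmodule ν) (x y : ℤ) :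
    cov[fun ω => f (shift x ω), fun ω => g (shift y ω); chainMeasure ν]
      = cov[f, fun ω => g (shift (y - x) ω); chainMeasure ν] := by
  have h := measurePreserving_shift ν x
  have := covariance_map_fun (μ := chainMeasure ν) (Z := shift x) (X := f)
    (Y := fun ω => g (shift (y - x) ω)) (by rw [h.map_eq]; exact hf.2.1.aestronglyMeasurable)
    (by rw [h.map_eq]; exact (hg.2.1.comp (measurable_shift _)).aestronglyMeasurable)
    h.measurable.aemeasurable
  rw [h.map_eq] at this
  rw [this]
  congr 1
  ext ω
  congr 1
  funext z
  simp only [shift]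
  congr 1
  ring

theorem fluct_comm {f g : Config → ℝ} (hf : f ∈ localSubmodule ν)
    (hg : g ∈ localSubmodule ν) : fluct ν f g = fluct ν g f := by
  rw [fluct_eq_cov hf hg, fluct_eq_cov hg hf, ← finsum_comp_equiv (Equiv.neg ℤ)]
  refine finsum_congr fun x => ?_
  have := cov_shift_shift hf hg x 0
  rw [covariance_comm] at this
  simp only [zero_sub] at this
  have h0 : (fun ω => g (shift 0 ω)) = g := by
    ext ω
    congr 1
    funext z
    simp [shift]
  rw [h0] at this
  simpa using this.symm

theorem fluct_add_left {f g h : Config → ℝ} (hf : f ∈ localSubmodule ν)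
    (hg : g ∈ localSubmodule ν) (hh : h ∈ localSubmodule ν) :
    fluct ν (f + g) h = fluct ν f h + fluct ν g h := by
  rw [fluct_eq_cov (add_mem hf hg) hh, fluct_eq_cov hf hh, fluct_eq_cov hg hh,
    ← finsum_add_distrib (finite_support_cov hf hh) (finite_support_cov hg hh)]
  exact finsum_congr fun x => covariance_add_left hf.2.2 hg.2.2 (memLp_shift hh x)

theorem fluct_smul_left {f g : Config → ℝ} (hf : f ∈ localSubmodule ν)
    (hg : g ∈ localSubmodule ν) (c : ℝ) :
    fluct ν (c • f) g = c * fluct ν f g := by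
  rw [fluct_eq_cov ((localSubmodule ν).smul_mem c hf) hg, fluct_eq_cov hf hg,
    ← smul_eq_mul, smul_finsum]
  exact finsum_congr fun x => covariance_smul_left c

/-- `≪f, f≫ ≥ 0`, because it is the limit of `N⁻¹ Var(∑_{0 ≤ x < N} θ_x f)`. -/
theorem fluct_self_nonneg {f : Config → ℝ} (hf : f ∈ localSubmodule ν) : 0 ≤ fluct ν f f := by
  rw [fluct_eq_cov hf hf]
  set c : ℤ → ℝ := fun x => cov[f, fun ω => f (shift x ω); chainMeasure ν] with hc
  have hfin := finite_support_cov hf hf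
  obtain ⟨m, hm⟩ : ∃ m : ℕ, ∀ x : ℤ, c x ≠ 0 → |x| ≤ m := by
    refine ⟨∑ x ∈ hfin.toFinset, x.natAbs, fun x hx => ?_⟩
    have := Finset.single_le_sum (f := fun x : ℤ => x.natAbs) (fun _ _ => Nat.zero_le _)
      (hfin.mem_toFinset.2 hx)
    rw [Int.abs_eq_natAbs]
    exact_mod_cast this
  set S := ∑ᶠ x : ℤ, c x with hS
  set C := ∑ x ∈ hfin.toFinset, |c x| with hC
  have hC0 : 0 ≤ C := Finset.sum_nonneg fun _ _ => abs_nonneg _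
  have hsub (s : Finset ℤ) : |∑ x ∈ s, c x| ≤ C := by
    refine (Finset.abs_sum_le_sum_abs _ _).trans ?_
    rw [← Finset.sum_filter_ne_zero]
    refine Finset.sum_le_sum_of_subset_of_nonneg (fun x hx => ?_) fun _ _ _ => abs_nonneg _
    simpa using (Finset.mem_filter.1 hx).2
  have hrow (N : ℕ) (i : ℤ) :
      ∑ j ∈ Finset.Ico (0 : ℤ) N, c (j - i) =
        ∑ x ∈ (Finset.Ico (0 : ℤ) N).map (Equiv.subRight i).toEmbedding, c x := by
    rw [Finset.sum_map]; rfl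
  have hkey (N : ℕ) : 0 ≤ ((N : ℝ)) * S + (2 * m) * (2 * C) := by
    have hvar : 0 ≤ ∑ i ∈ Finset.Ico (0 : ℤ) N, ∑ j ∈ Finset.Ico (0 : ℤ) N, c (j - i) := by
      have h1 := covariance_fun_sum_fun_sum' (μ := chainMeasure ν)
        (s := Finset.Ico (0 : ℤ) N) (t := Finset.Ico (0 : ℤ) N)
        (X := fun i ω => f (shift i ω)) (Y := fun i ω => f (shift i ω))
        (fun i _ => memLp_shift hf i) (fun i _ => memLp_shift hf i)
      simp_rw [cov_shift_shift hf hf] at h1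
      rw [← h1, covariance_self]
      · exact variance_nonneg _ _
      · exact (Finset.measurable_sum _ fun i _ =>
          hf.2.1.comp (measurable_shift i)).aemeasurable
    have hbd : ∀ i ∈ Finset.Ico (0 : ℤ) N, ∑ j ∈ Finset.Ico (0 : ℤ) N, c (j - i) ≤
        S + if i ∈ Finset.Ico (0 : ℤ) m ∪ Finset.Ico ((N : ℤ) - m) N then 2 * C else 0 := by
      intro i hi
      have hS' : S = ∑ x ∈ hfin.toFinset, c x := finsum_eq_sum _ hfin
      split_ifs with h
      · rw [hrow]
        have h1 := (abs_le.1 (hsub ((Finset.Ico (0 : ℤ) N).map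
          (Equiv.subRight i).toEmbedding))).2
        have h2 := (abs_le.1 (hsub hfin.toFinset)).1
        rw [hS']; linarith
      · rw [add_zero, hrow, hS]
        refine le_of_eq (finsum_eq_sum_of_support_subset _ fun x hx => ?_).symm
        have hx' := abs_le.1 (hm x hx)
        simp only [Finset.mem_union, Finset.mem_Ico, not_or, not_and, not_lt] at h hi
        simp only [Finset.coe_map, Set.mem_image, Finset.mem_coe, Finset.mem_Ico]
        refine ⟨x + i, ?_, by simp⟩
        have := h.1 hi.1
        have : i < (N : ℤ) - m := by
          by_contra hcon
          have := h.2 (not_lt.1 hcon)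
          omega
        omega
    have h2 := hvar.trans (Finset.sum_le_sum hbd)
    rw [Finset.sum_add_distrib, ← Finset.sum_filter] at h2
    simp only [Finset.sum_const, nsmul_eq_mul, Int.card_Ico, sub_zero, Int.toNat_natCast] at h2
    refine h2.trans (add_le_add_right ?_ _)
    refine mul_le_mul_of_nonneg_right ?_ (by positivity)
    have : ((Finset.Ico (0 : ℤ) N).filter
        (· ∈ Finset.Ico (0 : ℤ) m ∪ Finset.Ico ((N : ℤ) - m) N)).card ≤ 2 * m := by
      refine (Finset.card_le_card (t := Finset.Ico (0 : ℤ) m ∪ Finset.Ico ((N : ℤ) - m) N)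
        fun x hx => (Finset.mem_filter.1 hx).2).trans ((Finset.card_union_le _ _).trans ?_)
      simp; omega
    exact_mod_cast this
  by_contra hneg
  push Not at hneg
  obtain ⟨N, hN⟩ := exists_nat_gt ((2 * m) * (2 * C) / (-S))
  rw [div_lt_iff₀ (by linarith)] at hN
  have := hkey N
  linarith

end FluctFacts

section Hilbert

variable (ν : Measure (ℝ × ℝ)) [IsProbabilityMeasure ν]

/-- Square integrable local functions, as a type of its own, to be equipped with the seminorm
of `≪·, ·≫` (and not with the topology of pointwise convergence). -/
def LocalFn : Type := localSubmodule ν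

instance : AddCommGroup (LocalFn ν) := inferInstanceAs (AddCommGroup (localSubmodule ν))

instance : Module ℝ (LocalFn ν) := inferInstanceAs (Module ℝ (localSubmodule ν))

/-- The function underlying an element of `LocalFn ν`. -/
def LocalFn.fn {ν : Measure (ℝ × ℝ)} [IsProbabilityMeasure ν] (f : LocalFn ν) : Config → ℝ :=
  f.1

/-- `≪·, ·≫` is a positive semidefinite symmetric bilinear form on local functions. -/
@[reducible] def fluctCore : PreInnerProductSpace.Core ℝ (LocalFn ν) where
  inner f g := fluct ν f.fn g.fn
  conj_inner_symm f g := fluct_comm g.2 f.2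
  re_inner_nonneg f := fluct_self_nonneg f.2
  add_left f g h := fluct_add_left f.2 g.2 h.2
  smul_left f g c := fluct_smul_left f.2 g.2 c

instance : SeminormedAddCommGroup (LocalFn ν) :=
  @InnerProductSpace.Core.toSeminormedAddCommGroup ℝ (LocalFn ν) _ _ _ (fluctCore ν)

instance : InnerProductSpace ℝ (LocalFn ν) := InnerProductSpace.ofCore (fluctCore ν)

/-- The Hilbert space `𝓗`: the completion of the local functions with respect to `≪·, ·≫`. -/
abbrev FluctSpace : Type := UniformSpace.Completion (LocalFn ν)

theorem inner_coe_eq_fluct (f g : LocalFn ν) :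
    inner ℝ (f : FluctSpace ν) (g : FluctSpace ν) = fluct ν f.fn g.fn :=
  UniformSpace.Completion.inner_coe f g

end Hilbert

/-! ## Strongly continuous semigroups, generators, resolvents -/

/-- A strongly continuous one-parameter semigroup of bounded operators. -/
structure C0Semigroup (E : Type*) [NormedAddCommGroup E] [NormedSpace ℝ E] where
  toFun : ℝ≥0 → E →L[ℝ] E
  map_zero : toFun 0 = 1
  map_add : ∀ s t, toFun (s + t) = toFun s * toFun t
  continuous_orbit : ∀ x, Continuous fun t => toFun t x

namespace C0Semigroup

variable {E : Type*} [NormedAddCommGroup E] [NormedSpace ℝ E] (P : C0Semigroup E)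

/-- `y` is the derivative at `t = 0⁺` of the orbit `t ↦ P_t x`. -/
def HasGen (x y : E) : Prop :=
  Tendsto (fun t : ℝ≥0 => (t : ℝ)⁻¹ • (P.toFun t x - x)) (𝓝[>] 0) (𝓝 y)

variable {P}

theorem HasGen.add {x y x' y' : E} (h : P.HasGen x y) (h' : P.HasGen x' y') :
    P.HasGen (x + x') (y + y') := by
  refine (Tendsto.add h h').congr fun t => ?_
  rw [← smul_add, _root_.map_add]
  congr 1
  abel

theorem HasGen.smul {x y : E} (h : P.HasGen x y) (c : ℝ) : P.HasGen (c • x) (c • y) := by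
  refine (Tendsto.const_smul h c).congr fun t => ?_
  rw [_root_.map_smul, ← smul_sub, smul_comm]

instance : (𝓝[>] (0 : ℝ≥0)).NeBot := nhdsGT_neBot 0

theorem HasGen.unique {x y y' : E} (h : P.HasGen x y) (h' : P.HasGen x y') : y = y' :=
  tendsto_nhds_unique h h'

variable (P)

/-- The infinitesimal generator `L x = lim_{t → 0⁺} (P_t x - x) / t`, whose domain consists of all
`x` for which this limit exists in norm. -/
def generator : E →ₗ.[ℝ] E where
  domain :=
    { carrier := {x | ∃ y, P.HasGen x y}
      zero_mem' := ⟨0, by simp [HasGen]⟩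
      add_mem' := fun ⟨y, hy⟩ ⟨y', hy'⟩ => ⟨y + y', hy.add hy'⟩
      smul_mem' := fun c _ ⟨y, hy⟩ => ⟨c • y, hy.smul c⟩ }
  toFun :=
    { toFun := fun x => Classical.choose x.2
      map_add' := fun x x' => (Classical.choose_spec (x + x').2).unique
        ((Classical.choose_spec x.2).add (Classical.choose_spec x'.2))
      map_smul' := fun c x => (Classical.choose_spec (c • x).2).unique
        ((Classical.choose_spec x.2).smul c) }

end C0Semigroup

/-- The operator `lam - L`, defined on the domain of `L`. -/
def resolventMap {E : Type*} [NormedAddCommGroup E] [NormedSpace ℝ E]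
    (L : E →ₗ.[ℝ] E) (lam : ℝ) (u : L.domain) : E := lam • (u : E) - L u

/-- `(lam - L)⁻¹ g`: the inverse of `lam - L` applied to `g` (meaningful when `lam - L` is a
bijection from the domain of `L` onto the whole space). -/
def resolventApply {E : Type*} [NormedAddCommGroup E] [NormedSpace ℝ E]
    (L : E →ₗ.[ℝ] E) (lam : ℝ) (g : E) : E :=
  ((Function.invFun (resolventMap L lam) g : L.domain) : E)

/-! ## The chain at zero pressure -/

/-- The data of the infinite chain at zero pressure: a smooth interaction potential `V`, a
temperature `T > 0` and a noise intensity `γ > 0`, such that the Gibbs weight `e^{-V/T}` is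
normalizable and the force `V'` has a finite second moment under it. -/
structure OscillatorChain where
  V : ℝ → ℝ
  T : ℝ
  γ : ℝ
  smooth : ContDiff ℝ (⊤ : ℕ∞) V
  T_pos : 0 < T
  γ_pos : 0 < γ
  integrable_gibbs : Integrable fun r => Real.exp (-V r / T)
  integrable_force_sq : Integrable fun r => (deriv V r) ^ 2 * Real.exp (-V r / T)

namespace OscillatorChain

variable (D : OscillatorChain)

/-- The law of one pair `(r_x, p_x)` under the Gibbs measure `μ_{0,T}`: `r_x` has density
`Z⁻¹ e^{-V(r)/T}` and `p_x` is an independent centered Gaussian of variance `T`. -/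
def site : Measure (ℝ × ℝ) :=
  (volume.tilted fun r => -D.V r / D.T).prod (gaussianReal 0 D.T.toNNReal)

instance : IsProbabilityMeasure (volume.tilted fun r => -D.V r / D.T) :=
  isProbabilityMeasure_tilted D.integrable_gibbs

instance : IsProbabilityMeasure D.site := by unfold site; infer_instance

/-- The infinite volume Gibbs measure `μ_{0,T}`. -/
abbrev gibbs : Measure Config := chainMeasure D.site

/-- The Hilbert space `𝓗_{0,T}`. -/
abbrev hilbert : Type := FluctSpace D.site

/-- `∂_{r_x} f`. -/
def partialR (x : ℤ) (f : Config → ℝ) (ω : Config) : ℝ :=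
  deriv (fun s => f (Function.update ω x (s, (ω x).2))) (ω x).1

/-- `∂_{p_x} f`. -/
def partialP (x : ℤ) (f : Config → ℝ) (ω : Config) : ℝ :=
  deriv (fun s => f (Function.update ω x ((ω x).1, s))) (ω x).2

/-- The Liouville operator. For local `f` the sum has finitely many nonzero terms. -/
def liouville (f : Config → ℝ) (ω : Config) : ℝ :=
  ∑ᶠ x : ℤ, (((ω x).2 - (ω (x - 1)).2) * partialR x f ω
    + (deriv D.V (ω (x + 1)).1 - deriv D.V (ω x).1) * partialP x f ω)

/-- The noise operator: independent reversals of the momenta. -/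
def noise (f : Config → ℝ) (ω : Config) : ℝ := ∑ᶠ x : ℤ, (f (flipAt x ω) - f ω)

/-- The formal generator of the infinite dynamics. -/
def formalGen (f : Config → ℝ) (ω : Config) : ℝ := D.liouville f ω + D.γ * noise f ω

/-- The space `C_0^1(Ω)` of compactly supported, continuously differentiable local functions,
that is, the vector space spanned by the functions `ω ↦ F((ω x)_{x ∈ Λ})` with `Λ` finite and `F`
continuously differentiable with compact support. -/
def testFunctions : Submodule ℝ (Config → ℝ) :=
  Submodule.span ℝ {f | ∃ (Λ : Finset ℤ) (F : (Λ → ℝ × ℝ) → ℝ),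
    ContDiff ℝ 1 F ∧ HasCompactSupport F ∧ f = fun ω => F fun x => ω x}

/-- The graph, in `𝓗 × 𝓗`, of the formal generator on `C_0^1(Ω)`. -/
def preGraph : Set (D.hilbert × D.hilbert) :=
  {q | ∃ f g : LocalFn D.site, f.fn ∈ testFunctions ∧ g.fn = D.formalGen f.fn ∧
    q = ((f : D.hilbert), (g : D.hilbert))}

/-- The semigroup `P` on `𝓗` is the semigroup of the infinite dynamics: its generator extends the
formal generator on `C_0^1(Ω)`, and `C_0^1(Ω)` is dense in the domain of the generator for the
graph norm. -/
def IsDynamics (P : C0Semigroup D.hilbert) : Prop :=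
  (P.generator.graph : Set (D.hilbert × D.hilbert)) = closure D.preGraph

/-- The energy current `j_{0,1} = - p_0 V'(r_1)`. -/
def currentFn (ω : Config) : ℝ := -(ω 0).2 * deriv D.V (ω 1).1

theorem measurable_force : Measurable (deriv D.V) :=
  (D.smooth.continuous_deriv (by simp)).measurable

theorem memLp_force : MemLp (fun ω : Config => deriv D.V (ω 1).1) 2 D.gibbs := by
  have h1 : MemLp (deriv D.V) 2 (volume.tilted fun r => -D.V r / D.T) := by
    rw [memLp_two_iff_integrable_sq D.measurable_force.aestronglyMeasurable,
      integrable_tilted_iff D.integrable_gibbs]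
    simpa [mul_comm] using D.integrable_force_sq
  have h2 : MemLp (fun z : ℝ × ℝ => deriv D.V z.1) 2 D.site :=
    h1.comp_measurePreserving measurePreserving_fst
  exact h2.comp_measurePreserving (measurePreserving_eval_infinitePi (fun _ : ℤ => D.site) 1)

theorem memLp_momentum : MemLp (fun ω : Config => (ω 0).2) 2 D.gibbs := by
  have h1 : MemLp (id : ℝ → ℝ) 2 (gaussianReal 0 D.T.toNNReal) := memLp_id_gaussianReal 2
  have h2 : MemLp (fun z : ℝ × ℝ => z.2) 2 D.site :=
    h1.comp_measurePreserving measurePreserving_snd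
  exact h2.comp_measurePreserving (measurePreserving_eval_infinitePi (fun _ : ℤ => D.site) 0)

theorem currentFn_mem : D.currentFn ∈ localSubmodule D.site := by
  have hp : Measurable fun ω : Config => (ω 0).2 := measurable_snd.comp (measurable_pi_apply 0)
  have hr : Measurable fun ω : Config => deriv D.V (ω 1).1 :=
    D.measurable_force.comp (measurable_fst.comp (measurable_pi_apply 1))
  have hm : Measurable D.currentFn := hp.neg.mul hr
  refine ⟨⟨{0, 1}, fun a b h => ?_⟩, hm, ?_⟩
  · simp [currentFn, h 0 (by simp), h 1 (by simp)]
  · rw [memLp_two_iff_integrable_sq hm.aestronglyMeasurable]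
    have hi : IndepFun (fun ω : Config => (ω 0).2 ^ 2) (fun ω => deriv D.V (ω 1).1 ^ 2)
        D.gibbs := by
      refine indepFun_of_dependsOn (S := {0}) (T := {1}) (hp.pow_const 2) (hr.pow_const 2)
        (fun a b h => ?_) (fun a b h => ?_) (by simp)
      · simp [h 0 (by simp)]
      · simp [h 1 (by simp)]
    have := hi.integrable_mul D.memLp_momentum.integrable_sq D.memLp_force.integrable_sq
    refine this.congr (Eventually.of_forall fun ω => ?_)
    simp [currentFn, mul_pow]

/-- The energy current as a square integrable local function. -/
def currentLocal : LocalFn D.site := ⟨D.currentFn, D.currentFn_mem⟩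

/-- The energy current as an element of `𝓗`. -/
def current : D.hilbert := (D.currentLocal : D.hilbert)

/-- The regularized Green–Kubo coefficient `T⁻² ≪j_{0,1}, (lam - L)⁻¹ j_{0,1}≫`. -/
def greenKubo (P : C0Semigroup D.hilbert) (lam : ℝ) : ℝ :=
  (D.T ^ 2)⁻¹ * inner ℝ D.current (resolventApply P.generator lam D.current)

/-- The Green–Kubo conductivity `κ(T) = T⁻² lim_{lam → 0⁺} ≪j_{0,1}, (lam - L)⁻¹ j_{0,1}≫`. -/
def conductivity (P : C0Semigroup D.hilbert) : ℝ := limUnder (𝓝[>] 0) (D.greenKubo P)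

end OscillatorChain

end

/-! Let `R` be the reversal of all momenta, a symmetric isometric involution of `𝓗`. On test
functions the Liouville part of the generator `L` is antisymmetric for `≪·,·≫` and anticommutes with
`R`, while the noise part is symmetric and commutes with `R`. Hence `R L` is symmetric. A function
odd in exactly `k` momenta and even in the others is an eigenvector of the noise with eigenvalue
`-2k`. Functions odd under `R` only involve odd `k`, so `k ≥ 1`, and this gives the coercivity
estimate `-⟨u, L u⟩ ≥ (γ/2) ‖u - R u‖²`. Both relations are closed conditions, so they extend from
`C_0^1(Ω)` to the graph of the generator. The estimate makes `L` dissipative, the semigroup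
contractive, and `lam - L` bijective.

Existence of the limit: put `u = (lam - L)⁻¹ j` and `F(lam) = ⟨j, u⟩`. As `j` is odd, it sees only
the odd part of `u`, and coercivity bounds that part uniformly in `lam`. The resolvent identity and
the symmetry of `R L` give `F' = ⟨R u, u⟩ ≥ -‖u - R u‖²/4`. So `F' ≥ -C`, the function `F + C lam`
is nondecreasing and nonnegative, and it has a limit at `0⁺`.

The bound: estimating `⟨j, u⟩` directly gives a constant twice too large. The kinetic energy `φ =
p_0²/2` is invariant under the noise, so formally `L φ = ψ = p_0 (V'(r_1) - V'(r_0))`. Replacing `j`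
by `j + ψ/2 = -p_0 (V'(r_1) + V'(r_0))/2` costs only `(lam/2) ⟨φ, u⟩`, which the energy estimate
absorbs up to `O(lam)`. At zero pressure the forces are centered and uncorrelated, whence `‖j +
ψ/2‖² = T Var(V')/2`, half of `‖j‖²`.

The argument rests on `exists_tendsto_inner_resolventApply` (abstract limit and bound),
`resolventMap_bijective`, `integral_liouville` (invariance of the Gibbs measure), `noise_gap` and
`inner_symmCurrent_self`. -/

noncomputable section

namespace C0Semigroup

/-! ### Strongly continuous semigroups: domain of the generator and exponential rescaling -/

section Banach

variable {E : Type*} [NormedAddCommGroup E] [NormedSpace ℝ E] (P : C0Semigroup E)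

theorem toFun_add_apply (s t : ℝ≥0) (x : E) : P.toFun (s + t) x = P.toFun s (P.toFun t x) := by
  rw [P.map_add]; rfl

theorem toFun_comm_apply (s t : ℝ≥0) (x : E) :
    P.toFun s (P.toFun t x) = P.toFun t (P.toFun s x) := by
  rw [← P.toFun_add_apply, add_comm, P.toFun_add_apply]

theorem continuous_orbit_toNNReal (x : E) : Continuous fun s : ℝ => P.toFun s.toNNReal x :=
  (P.continuous_orbit x).comp continuous_real_toNNReal

theorem mem_generator_graph_iff {x y : E} : (x, y) ∈ P.generator.graph ↔ P.HasGen x y := by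
  rw [LinearPMap.mem_graph_iff]
  constructor
  · rintro ⟨u, rfl, rfl⟩
    exact Classical.choose_spec u.2
  · intro h
    exact ⟨⟨x, y, h⟩, rfl, HasGen.unique (Classical.choose_spec (⟨y, h⟩ : ∃ y, P.HasGen x y)) h⟩

theorem tendsto_coe_nhdsGT_nhdsNE :
    Tendsto (fun t : ℝ≥0 => (t : ℝ)) (𝓝[>] 0) (𝓝[≠] 0) := by
  refine tendsto_nhdsWithin_iff.2 ⟨?_, ?_⟩
  · exact (NNReal.continuous_coe.tendsto' 0 0 rfl).mono_left nhdsWithin_le_nhds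
  · filter_upwards [self_mem_nhdsWithin] with t ht
    exact NNReal.coe_ne_zero.2 (ne_of_gt ht)

/-- Integrals of orbits belong to the domain of the generator. -/
theorem hasGen_integral [CompleteSpace E] (x : E) (τ : ℝ≥0) :
    P.HasGen (∫ s in (0 : ℝ)..τ, P.toFun s.toNNReal x) (P.toFun τ x - x) := by
  set g : ℝ → E := fun s => P.toFun s.toNNReal x with hg
  have hc : Continuous g := P.continuous_orbit_toNNReal x
  have hd (b : ℝ) : HasDerivAt (fun b => ∫ s in (0 : ℝ)..b, g s) (g b) b :=
    intervalIntegral.integral_hasDerivAt_right (hc.intervalIntegrable _ _)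
      hc.aestronglyMeasurable.stronglyMeasurableAtFilter hc.continuousAt
  -- By the semigroup law `(P_t - 1) ∫_0^τ` equals `∫_τ^{τ+t} - ∫_0^t`, so the difference quotient
  -- is a difference of two slopes of the same primitive, at `τ` and at `0`.
  have h1 := ((hasDerivAt_iff_tendsto_slope_zero.1 (hd τ)).sub
    (hasDerivAt_iff_tendsto_slope_zero.1 (hd 0))).comp tendsto_coe_nhdsGT_nhdsNE
  have e1 : g τ - g 0 = P.toFun τ x - x := by simp [hg, P.map_zero]
  rw [e1] at h1
  refine h1.congr fun t => ?_
  simp only [Function.comp, zero_add, intervalIntegral.integral_same, sub_zero]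
  rw [← smul_sub]
  congr 1
  have e2 : P.toFun t (∫ s in (0 : ℝ)..τ, g s) = ∫ s in (t : ℝ)..(τ + t), g s := by
    rw [← ContinuousLinearMap.intervalIntegral_comp_comm _ (hc.intervalIntegrable _ _)]
    have := intervalIntegral.integral_comp_add_right (a := (0 : ℝ)) (b := τ) g (t : ℝ)
    rw [zero_add] at this
    rw [← this]
    refine intervalIntegral.integral_congr fun s hs => ?_
    rw [Set.uIcc_of_le τ.coe_nonneg] at hs
    simp only [hg]
    rw [← P.toFun_add_apply, Real.toNNReal_add hs.1 t.coe_nonneg, Real.toNNReal_coe, add_comm]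
  have e3 : (∫ s in (0 : ℝ)..(τ + t), g s) - ∫ s in (0 : ℝ)..t, g s
      = ∫ s in (t : ℝ)..(τ + t), g s :=
    intervalIntegral.integral_interval_sub_left (hc.intervalIntegrable _ _)
      (hc.intervalIntegrable _ _)
  rw [e2, ← e3]
  abel

/-- The domain of the generator is dense. -/
theorem dense_domain [CompleteSpace E] : Dense {x : E | ∃ y, P.HasGen x y} := by
  intro x
  have hc := P.continuous_orbit_toNNReal x
  have hd : HasDerivAt (fun b => ∫ s in (0 : ℝ)..b, P.toFun s.toNNReal x)
      (P.toFun (0 : ℝ).toNNReal x) 0 :=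
    intervalIntegral.integral_hasDerivAt_right (hc.intervalIntegrable _ _)
      hc.aestronglyMeasurable.stronglyMeasurableAtFilter hc.continuousAt
  -- The averages `t⁻¹ ∫_0^t P_s x ds` lie in the domain and converge to `x`.
  have h1 := (hasDerivAt_iff_tendsto_slope_zero.1 hd).comp tendsto_coe_nhdsGT_nhdsNE
  simp only [Real.toNNReal_zero, P.map_zero, one_apply_eq_self] at h1
  refine mem_closure_of_tendsto h1 (Eventually.of_forall fun t => ?_)
  simp only [Function.comp, zero_add, intervalIntegral.integral_same, sub_zero]
  exact ⟨_, (P.hasGen_integral x t).smul _⟩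

/-- The semigroup `e^{-lam t} P_t`. -/
def rescale (lam : ℝ) : C0Semigroup E where
  toFun t := Real.exp (-lam * t) • P.toFun t
  map_zero := by simp [P.map_zero]
  map_add s t := by
    rw [P.map_add, smul_mul_smul_comm, ← Real.exp_add]
    push_cast
    ring_nf
  continuous_orbit x := by
    have := P.continuous_orbit x
    change Continuous fun t : ℝ≥0 => Real.exp (-lam * t) • P.toFun t x
    fun_prop

/-- Product rule: the difference quotient of `P` is `e^{lam t}` times that of the rescaled semigroup
plus `t⁻¹ (e^{lam t} - 1) x`. -/
theorem HasGen.of_rescale {lam : ℝ} {x y : E} (h : (P.rescale lam).HasGen x y) :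
    P.HasGen x (y + lam • x) := by
  have hd : HasDerivAt (fun t : ℝ => Real.exp (lam * t)) lam 0 := by
    have := ((hasDerivAt_id (0 : ℝ)).const_mul lam).exp
    simpa using this
  have h1 := (hasDerivAt_iff_tendsto_slope_zero.1 hd).comp tendsto_coe_nhdsGT_nhdsNE
  have h2 : Tendsto (fun t : ℝ≥0 => Real.exp (lam * t)) (𝓝[>] 0) (𝓝 1) := by
    have : Continuous fun t : ℝ≥0 => Real.exp (lam * t) := by fun_prop
    exact (this.tendsto' 0 1 (by simp)).mono_left nhdsWithin_le_nhds
  have h3 := (h2.smul h).add (h1.smul_const x)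
  rw [one_smul] at h3
  refine h3.congr fun t => ?_
  have e : Real.exp (lam * t) * Real.exp (-lam * t) = 1 := by
    rw [← Real.exp_add]; simp
  simp only [Function.comp, zero_add, mul_zero, Real.exp_zero, rescale,
    smul_apply, smul_eq_mul]
  rw [smul_comm, mul_smul, ← smul_add, smul_sub, smul_smul, e, one_smul, sub_smul, one_smul]
  congr 1
  abel

end Banach

/-! ### Dissipative generators: contractivity and resolvents -/

section Hilbert

variable {E : Type*} [NormedAddCommGroup E] [InnerProductSpace ℝ E] (P : C0Semigroup E)

theorem HasGen.toFun {x y : E} (h : P.HasGen x y) (t : ℝ≥0) :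
    P.HasGen (P.toFun t x) (P.toFun t y) := by
  refine (((P.toFun t).continuous.tendsto y).comp h).congr fun s => ?_
  simp only [Function.comp, _root_.map_smul, map_sub]
  rw [P.toFun_comm_apply]

theorem HasGen.hasDerivWithinAt {x y : E} (h : P.HasGen x y) {t : ℝ} (ht : 0 ≤ t) :
    HasDerivWithinAt (fun s : ℝ => P.toFun s.toNNReal x) (P.toFun t.toNNReal y) (Set.Ici t) t := by
  rw [← hasDerivWithinAt_Ioi_iff_Ici, hasDerivWithinAt_iff_tendsto_slope' (by simp)]
  have hm : Tendsto (fun s : ℝ => (s - t).toNNReal) (𝓝[>] t) (𝓝[>] 0) := by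
    refine tendsto_nhdsWithin_iff.2 ⟨?_, ?_⟩
    · have : Continuous fun s : ℝ => (s - t).toNNReal := by fun_prop
      exact (this.tendsto' t 0 (by simp)).mono_left nhdsWithin_le_nhds
    · filter_upwards [self_mem_nhdsWithin] with s hs
      simpa using hs
  refine ((((P.toFun t.toNNReal).continuous.tendsto y).comp h).comp hm).congr' ?_
  filter_upwards [self_mem_nhdsWithin] with s hs
  have hs' : 0 ≤ s - t := sub_nonneg.2 (le_of_lt hs)
  have e : s.toNNReal = t.toNNReal + (s - t).toNNReal := by
    rw [← Real.toNNReal_add ht hs']; simp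
  simp only [Function.comp, _root_.map_smul, map_sub, slope_def_module, Real.coe_toNNReal _ hs']
  rw [e, P.toFun_add_apply]

/-- A strongly continuous semigroup with dissipative generator is contractive. -/
theorem norm_toFun_le [CompleteSpace E] (hP : ∀ x y, P.HasGen x y → inner ℝ x y ≤ 0) (t : ℝ≥0) :
    ‖P.toFun t‖ ≤ 1 := by
  refine ContinuousLinearMap.opNorm_le_bound _ zero_le_one fun x => ?_
  rw [one_mul]
  refine P.dense_domain.induction (P := fun x => ‖P.toFun t x‖ ≤ ‖x‖) ?_
    (isClosed_le (by fun_prop) (by fun_prop)) x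
  rintro x ⟨y, h⟩
  have hsq : ‖P.toFun t x‖ ^ 2 ≤ ‖x‖ ^ 2 := by
    -- On the domain, `‖P_s x‖²` has right derivative `2 ⟨P_s x, L P_s x⟩ ≤ 0`; one-sided
    -- derivatives are enough for this comparison principle.
    have h1 := image_le_of_deriv_right_le_deriv_boundary (a := 0) (b := (t : ℝ))
      (f := fun s : ℝ => ‖P.toFun s.toNNReal x‖ ^ 2)
      (f' := fun s => 2 * inner ℝ (P.toFun s.toNNReal x) (P.toFun s.toNNReal y))
      (B := fun _ => ‖x‖ ^ 2) (B' := fun _ => 0)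
      ((P.continuous_orbit_toNNReal x).norm.pow 2).continuousOn
      (fun s hs => (h.hasDerivWithinAt P hs.1).norm_sq)
      (by simp [P.map_zero]) continuousOn_const (fun s _ => hasDerivWithinAt_const _ _ _)
      (fun s _ => by
        have := hP _ _ (h.toFun P s.toNNReal)
        linarith)
      (Set.right_mem_Icc.2 t.2)
    simpa using h1
  exact le_of_sq_le_sq hsq (norm_nonneg _)

/-- Injectivity is dissipativity applied to a difference `w` with `L w = lam w`. Surjectivity avoids
the Laplace integral over `[0, ∞)`: with `Q_t = e^{-lam t} P_t` the operator `1 - Q_1` is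
invertible, and if `x - Q_1 x = g`, then `∫_0^1 Q_s x ds` is sent to `g` by `lam - L`. -/
theorem resolventMap_bijective [CompleteSpace E]
    (hP : ∀ x y, P.HasGen x y → inner ℝ x y ≤ 0) {lam : ℝ} (hlam : 0 < lam) :
    Function.Bijective (resolventMap P.generator lam) := by
  have hgen (u : P.generator.domain) : P.HasGen u (P.generator u) :=
    P.mem_generator_graph_iff.1 (P.generator.mem_graph u)
  constructor
  · intro u v huv
    have h := (hgen u).add ((hgen v).smul (-1))
    have h1 := hP _ _ h
    have e : P.generator u + (-1 : ℝ) • P.generator v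
        = lam • ((u : E) + (-1 : ℝ) • (v : E)) := by
      have : lam • (u : E) - P.generator u = lam • (v : E) - P.generator v := huv
      rw [sub_eq_sub_iff_add_eq_add] at this
      have h2 : P.generator u = lam • (u : E) + P.generator v - lam • (v : E) := by
        rw [this]; abel
      rw [h2, smul_add, smul_comm lam (-1 : ℝ), neg_one_smul, neg_one_smul]
      abel
    rw [e, inner_smul_right, real_inner_self_eq_norm_sq] at h1
    have h2 : ‖(u : E) + (-1 : ℝ) • (v : E)‖ ^ 2 ≤ 0 := by
      by_contra hc
      push Not at hc
      nlinarith [mul_pos hlam hc]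
    have h3 : (u : E) + (-1 : ℝ) • (v : E) = 0 := by
      rw [← norm_eq_zero]
      exact pow_eq_zero_iff two_ne_zero |>.1 (le_antisymm h2 (sq_nonneg _))
    rw [neg_one_smul, ← sub_eq_add_neg, sub_eq_zero] at h3
    exact Subtype.ext h3
  · intro g
    -- The time `1` is arbitrary: at any positive time the rescaled contraction has norm below `1`,
    -- and the Neumann series inverts `1 - Q_1`.
    have hlt : ‖(P.rescale lam).toFun 1‖ < 1 := by
      calc ‖(P.rescale lam).toFun 1‖ = Real.exp (-lam * (1 : ℝ≥0)) * ‖P.toFun 1‖ := by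
            change ‖Real.exp (-lam * (1 : ℝ≥0)) • P.toFun 1‖ = _
            rw [norm_smul, Real.norm_of_nonneg (Real.exp_pos _).le]
        _ ≤ Real.exp (-lam * (1 : ℝ≥0)) :=
            mul_le_of_le_one_right (Real.exp_pos _).le (P.norm_toFun_le hP 1)
        _ < 1 := by simpa using hlam
    obtain ⟨U, hU⟩ := isUnit_one_sub_of_norm_lt_one hlt
    set x : E := (↑U⁻¹ : E →L[ℝ] E) g with hx
    have hxg : x - (P.rescale lam).toFun 1 x = g := by
      have : ((U : E →L[ℝ] E) * (↑U⁻¹ : E →L[ℝ] E)) g = g := by rw [Units.mul_inv]; rfl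
      rw [hU] at this
      exact this
    have h := HasGen.of_rescale P ((P.rescale lam).hasGen_integral x 1)
    refine ⟨⟨_, _, h⟩, ?_⟩
    unfold resolventMap
    rw [(hgen ⟨_, _, h⟩).unique h, ← hxg]
    simp

end Hilbert

end C0Semigroup

namespace C0Semigroup

/-! ### The abstract Green–Kubo limit and its variational bound -/

section GreenKubo

variable {E : Type*} [NormedAddCommGroup E] [InnerProductSpace ℝ E] (P : C0Semigroup E)

theorem hasGen_resolventApply [CompleteSpace E] (hP : ∀ x y, P.HasGen x y → inner ℝ x y ≤ 0) {lam : ℝ}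
    (hlam : 0 < lam) (g : E) :
    P.HasGen (resolventApply P.generator lam g)
      (lam • resolventApply P.generator lam g - g) := by
  have h := Function.rightInverse_invFun (P.resolventMap_bijective hP hlam).2 g
  set u := Function.invFun (resolventMap P.generator lam) g with hu
  have h1 : P.HasGen u (P.generator u) :=
    P.mem_generator_graph_iff.1 (P.generator.mem_graph u)
  have h2 : lam • (u : E) - P.generator u = g := h
  have h3 : P.generator u = lam • (u : E) - g := by rw [← h2]; abel
  rw [h3] at h1
  exact h1

variable {P} {R : E →L[ℝ] E}

/-- An odd vector pairs only with the odd part `(u - R u)/2`, the part on which there is coercivity.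
-/
theorem inner_odd_eq (hRs : ∀ u v, inner ℝ (R u) v = inner ℝ u (R v)) {a : E} (ha : R a = -a)
    (u : E) : inner ℝ a u = 1 / 2 * inner ℝ a (u - R u) := by
  have : inner ℝ a (R u) = -inner ℝ a u := by rw [← hRs, ha, inner_neg_left]
  rw [inner_sub_right, this]
  ring

/-- If the generator is symmetric with respect to the indefinite form `⟨R ·, ·⟩` of an isometric
involution `R`, and if its symmetric part has a gap on the odd subspace of `R`, then
`⟨j, (lam - L)⁻¹ j⟩` has a limit as `lam → 0⁺` for all odd `j`, which is bounded through any
representation of `j` modulo the image under `L` of an even vector. -/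
theorem exists_tendsto_inner_resolventApply [CompleteSpace E]
    (hRs : ∀ u v, inner ℝ (R u) v = inner ℝ u (R v)) {γ : ℝ} (hγ : 0 < γ)
    (hdiss : ∀ u v, P.HasGen u v → γ / 2 * ‖u - R u‖ ^ 2 ≤ -inner ℝ u v)
    (hrev : ∀ u v u' v', P.HasGen u v → P.HasGen u' v' → inner ℝ (R v) u' = inner ℝ (R u) v')
    {j φ ψ : E} (hj : R j = -j) (hφ : R φ = φ) (hψ : R ψ = -ψ)
    (hφψ : ∀ u v, P.HasGen u v → inner ℝ ψ u = -inner ℝ φ v) :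
    ∃ l, Tendsto (fun lam => inner ℝ j (resolventApply P.generator lam j)) (𝓝[>] 0) (𝓝 l) ∧
      l ≤ ‖j + (1 / 2 : ℝ) • ψ‖ ^ 2 / (2 * γ) := by
  have hP : ∀ x y, P.HasGen x y → inner ℝ x y ≤ 0 := fun x y h => by
    have := hdiss x y h
    have : 0 ≤ γ / 2 * ‖x - R x‖ ^ 2 := by positivity
    linarith
  set u : ℝ → E := fun lam => resolventApply P.generator lam j with hu
  set F : ℝ → ℝ := fun lam => inner ℝ j (u lam) with hF
  have hgen {lam : ℝ} (hlam : 0 < lam) : P.HasGen (u lam) (lam • u lam - j) :=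
    P.hasGen_resolventApply hP hlam j
  have henergy {lam : ℝ} (hlam : 0 < lam) :
      lam * ‖u lam‖ ^ 2 + γ / 2 * ‖u lam - R (u lam)‖ ^ 2 ≤ F lam := by
    have := hdiss _ _ (hgen hlam)
    rw [inner_sub_right, inner_smul_right, real_inner_self_eq_norm_sq, real_inner_comm] at this
    simp only [hF]
    linarith
  -- The energy bound is quadratic in `u - R u` and `F` is at most linear in it, so the odd part
  -- stays bounded as `lam → 0`; no such bound is available for `u` itself.
  have hodd {lam : ℝ} (hlam : 0 < lam) : ‖u lam - R (u lam)‖ ≤ ‖j‖ / γ := by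
    have h1 := henergy hlam
    have h2 : F lam ≤ 1 / 2 * (‖j‖ * ‖u lam - R (u lam)‖) := by
      simp only [hF]
      rw [inner_odd_eq hRs hj]
      exact mul_le_mul_of_nonneg_left (real_inner_le_norm _ _) (by norm_num)
    have h3 : 0 ≤ lam * ‖u lam‖ ^ 2 := by positivity
    rw [le_div_iff₀ hγ]
    by_contra hc
    push Not at hc
    have h4 : 0 < ‖u lam - R (u lam)‖ := by
      by_contra h0
      have : ‖u lam - R (u lam)‖ = 0 := le_antisymm (not_lt.1 h0) (norm_nonneg _)
      rw [this, zero_mul] at hc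
      exact absurd hc (not_lt.2 (norm_nonneg _))
    nlinarith [mul_lt_mul_of_pos_right hc h4]
  -- Polarization: `4 ⟨R x, x⟩ = ‖x + R x‖² - ‖x - R x‖²`.
  have hindef (x : E) : -(‖x - R x‖ ^ 2 / 4) ≤ inner ℝ (R x) x := by
    have h1 := norm_sub_sq_real x (R x)
    have h2 := norm_add_sq_real x (R x)
    have h3 := sq_nonneg ‖x + R x‖
    rw [real_inner_comm] at h1 h2
    linarith
  -- Resolvent identity in the indefinite form `⟨R ·, ·⟩`, for which `L` is symmetric; the sign
  -- comes from `R j = -j`.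
  have hdiff {lam μ : ℝ} (hlam : 0 < lam) (hμ : 0 < μ) :
      F lam - F μ = (lam - μ) * inner ℝ (R (u lam)) (u μ) := by
    have h1 := hrev _ _ _ _ (hgen hlam) (hgen hμ)
    rw [map_sub, _root_.map_smul, hj, inner_sub_left, inner_sub_right, inner_smul_left,
      inner_smul_right, inner_neg_left, hRs (u lam) j, hj, inner_neg_right,
      real_inner_comm j (u lam)] at h1
    simp only [hF, conj_trivial] at h1 ⊢
    linarith
  -- Dissipativity applied to `u lam - u μ` gives `lam ‖u lam - u μ‖ ≤ |lam - μ| ‖u μ‖`.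
  have hcont {μ : ℝ} (hμ : 0 < μ) : Tendsto u (𝓝 μ) (𝓝 (u μ)) := by
    rw [tendsto_iff_norm_sub_tendsto_zero]
    have hlim : Tendsto (fun lam : ℝ => |lam - μ| * ‖u μ‖ / lam) (𝓝 μ) (𝓝 0) := by
      have : ContinuousAt (fun lam : ℝ => |lam - μ| * ‖u μ‖ / lam) μ :=
        ContinuousAt.div (by fun_prop) continuousAt_id hμ.ne'
      simpa [ContinuousAt] using this
    refine squeeze_zero' (Eventually.of_forall fun _ => norm_nonneg _) ?_ hlim
    filter_upwards [lt_mem_nhds hμ] with lam hlam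
    have h1 := hP _ _ ((hgen hlam).add ((hgen hμ).smul (-1)))
    have e : lam • u lam - j + (-1 : ℝ) • (μ • u μ - j)
        = lam • (u lam - u μ) + (lam - μ) • u μ := by
      module
    have e' : u lam + (-1 : ℝ) • u μ = u lam - u μ := by module
    rw [e, e', inner_add_right, inner_smul_right, inner_smul_right,
      real_inner_self_eq_norm_sq] at h1
    have h2 := abs_real_inner_le_norm (u lam - u μ) (u μ)
    have h3 : lam * ‖u lam - u μ‖ ^ 2 ≤ |lam - μ| * (‖u lam - u μ‖ * ‖u μ‖) := by
      calc lam * ‖u lam - u μ‖ ^ 2 ≤ -((lam - μ) * inner ℝ (u lam - u μ) (u μ)) := by linarith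
        _ ≤ |(lam - μ) * inner ℝ (u lam - u μ) (u μ)| := neg_le_abs _
        _ ≤ _ := by
          rw [abs_mul]
          exact mul_le_mul_of_nonneg_left h2 (abs_nonneg _)
    rw [le_div_iff₀ hlam]
    rcases (norm_nonneg (u lam - u μ)).eq_or_lt with h0 | h0
    · rw [← h0, zero_mul]; positivity
    · refine le_of_mul_le_mul_right ?_ h0
      linarith
  have hderiv {μ : ℝ} (hμ : 0 < μ) : HasDerivAt F (inner ℝ (R (u μ)) (u μ)) μ := by
    rw [hasDerivAt_iff_tendsto_slope]
    have h1 : Tendsto (fun lam => inner ℝ (R (u lam)) (u μ)) (𝓝[≠] μ)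
        (𝓝 (inner ℝ (R (u μ)) (u μ))) :=
      (((R.continuous.tendsto _).comp (hcont hμ)).inner tendsto_const_nhds).mono_left
        nhdsWithin_le_nhds
    refine h1.congr' ?_
    filter_upwards [self_mem_nhdsWithin, nhdsWithin_le_nhds (lt_mem_nhds hμ)] with lam hne hlam
    rw [slope_def_field, hdiff hlam hμ, mul_div_cancel_left₀ _ (sub_ne_zero.2 hne)]
  -- `C` is the uniform bound for `-F'` given by `hindef` and `hodd`.
  set C : ℝ := (‖j‖ / γ) ^ 2 / 4 with hC
  have hmono : MonotoneOn (fun lam => F lam + C * lam) (Set.Ioi 0) := by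
    have hd {μ : ℝ} (hμ : 0 < μ) :
        HasDerivAt (fun lam => F lam + C * lam) (inner ℝ (R (u μ)) (u μ) + C) μ := by
      have h := (hderiv hμ).add ((hasDerivAt_id μ).const_mul C)
      rw [mul_one] at h
      exact h
    refine monotoneOn_of_deriv_nonneg (convex_Ioi 0)
      (fun μ hμ => (hd hμ).continuousAt.continuousWithinAt)
      (fun μ hμ => (hd (by simpa using hμ)).differentiableAt.differentiableWithinAt)
      fun μ hμ => ?_
    have hμ' : 0 < μ := by simpa using hμ
    rw [(hd hμ').deriv]
    have h1 := hindef (u μ)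
    have h2 := pow_le_pow_left₀ (norm_nonneg _) (hodd hμ') 2
    rw [hC]
    linarith
  have hnonneg {lam : ℝ} (hlam : 0 < lam) : 0 ≤ F lam :=
    le_trans (by positivity) (henergy hlam)
  have hlim := MonotoneOn.tendsto_nhdsWithin_Ioo_right (f := fun lam => F lam + C * lam)
    (x := (0 : ℝ)) (y := 1) (Set.nonempty_Ioo.2 one_pos)
    (hmono.mono Set.Ioo_subset_Ioi_self)
    ⟨0, by
      rintro _ ⟨lam, hlam, rfl⟩
      have := hnonneg hlam.1
      have : 0 ≤ C * lam := mul_nonneg (by positivity) hlam.1.le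
      simp only
      linarith⟩
  set l := sInf ((fun lam => F lam + C * lam) '' Set.Ioo 0 1)
  have hCl : Tendsto (fun lam : ℝ => C * lam) (𝓝[>] 0) (𝓝 0) :=
    ((continuous_const_mul C).tendsto' 0 0 (by simp)).mono_left nhdsWithin_le_nhds
  have hFl : Tendsto F (𝓝[>] 0) (𝓝 l) := by
    have := hlim.sub hCl
    simpa using this
  refine ⟨l, hFl, ?_⟩
  set s := ‖j + (1 / 2 : ℝ) • ψ‖ with hs
  have hrhs : Tendsto (fun lam : ℝ => s ^ 2 / (2 * γ) + lam * (‖φ‖ ^ 2 / 4)) (𝓝[>] 0)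
      (𝓝 (s ^ 2 / (2 * γ))) := by
    have : Continuous fun lam : ℝ => s ^ 2 / (2 * γ) + lam * (‖φ‖ ^ 2 / 4) := by fun_prop
    exact (this.tendsto' 0 _ (by simp)).mono_left nhdsWithin_le_nhds
  refine le_of_tendsto_of_tendsto hFl hrhs ?_
  filter_upwards [self_mem_nhdsWithin] with lam hlam
  have hlam : 0 < lam := hlam
  have hφj : inner ℝ φ j = 0 := by
    have := hRs φ j
    rw [hφ, hj, inner_neg_right] at this
    linarith
  -- Write `⟨j, u⟩ = ⟨j + ψ/2, u⟩ - ⟨ψ, u⟩/2`. The last term is `⟨φ, L u⟩/2` with `L u = lam u - j`,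
  -- and `⟨φ, j⟩ = 0` by parity.
  have h1 : F lam = 1 / 2 * inner ℝ (j + (1 / 2 : ℝ) • ψ) (u lam - R (u lam))
      + 1 / 2 * lam * inner ℝ φ (u lam) := by
    rw [← inner_odd_eq hRs (by rw [_root_.map_add, _root_.map_smul, hj, hψ]; module), inner_add_left,
      inner_smul_left, hφψ _ _ (hgen hlam), inner_sub_right, inner_smul_right, hφj]
    simp only [hF, conj_trivial]
    ring
  have h2 := real_inner_le_norm (j + (1 / 2 : ℝ) • ψ) (u lam - R (u lam))
  have h3 := real_inner_le_norm φ (u lam)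
  have h4 := henergy hlam
  set w := ‖u lam - R (u lam)‖
  -- The weights here and in `h7` are chosen so that half of the quadratic terms is at most `F lam /
  -- 2` by the energy bound; solving for `F lam` gives the claim.
  have h5 : s * w ≤ s ^ 2 / (2 * γ) + γ / 2 * w ^ 2 := by
    have e : s ^ 2 / (2 * γ) + γ / 2 * w ^ 2 - s * w = (s - γ * w) ^ 2 / (2 * γ) := by
      field_simp
      ring
    have : 0 ≤ (s - γ * w) ^ 2 / (2 * γ) := by positivity
    linarith
  have h6 : lam * inner ℝ φ (u lam) ≤ lam * (‖φ‖ * ‖u lam‖) :=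
    mul_le_mul_of_nonneg_left h3 hlam.le
  have h7 : lam * (‖φ‖ * ‖u lam‖) ≤ lam * (‖u lam‖ ^ 2 + ‖φ‖ ^ 2 / 4) :=
    mul_le_mul_of_nonneg_left (by nlinarith [sq_nonneg (‖φ‖ / 2 - ‖u lam‖)]) hlam.le
  linarith

end GreenKubo

end C0Semigroup

/-! ### Transformations of the product measure and integration by parts -/

section ProductMeasure

variable {ν : Measure (ℝ × ℝ)} [IsProbabilityMeasure ν]

theorem measurePreserving_sitewise {φ : ℤ → ℝ × ℝ → ℝ × ℝ}
    (hφ : ∀ i, MeasurePreserving (φ i) ν ν) :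
    MeasurePreserving (fun (ω : Config) i => φ i (ω i)) (chainMeasure ν) (chainMeasure ν) := by
  have hm : Measurable fun (ω : Config) i => φ i (ω i) :=
    measurable_pi_iff.2 fun i => (hφ i).measurable.comp (measurable_pi_apply i)
  refine ⟨hm, ?_⟩
  unfold chainMeasure
  apply Measure.eq_infinitePi
  intro s t ht
  rw [Measure.map_apply hm (MeasurableSet.pi s.countable_toSet fun i _ => ht i)]
  have : (fun (ω : Config) i => φ i (ω i)) ⁻¹' (Set.pi (s : Set ℤ) t)
      = Set.pi (s : Set ℤ) fun i => φ i ⁻¹' t i := rfl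
  rw [this, Measure.infinitePi_pi _ fun i _ => (hφ i).measurable (ht i)]
  exact Finset.prod_congr rfl fun i _ => (hφ i).measure_preimage (ht i).nullMeasurableSet

/-- Replacing one site by an independent copy does not change the product measure. This turns
integrals over the infinite product into iterated integrals with an inner one over a single site. -/
theorem measurePreserving_resample (x : ℤ) :
    MeasurePreserving (fun q : Config × (ℝ × ℝ) => Function.update q.1 x q.2)
      ((chainMeasure ν).prod ν) (chainMeasure ν) := by
  have hm : Measurable fun q : Config × (ℝ × ℝ) => Function.update q.1 x q.2 :=
    measurable_update'.comp (measurable_fst.prodMk measurable_snd)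
  refine ⟨hm, ?_⟩
  conv_rhs => unfold chainMeasure
  apply Measure.eq_infinitePi
  intro s t ht
  rw [Measure.map_apply hm (MeasurableSet.pi s.countable_toSet fun i _ => ht i)]
  by_cases hx : x ∈ s
  · have : (fun q : Config × (ℝ × ℝ) => Function.update q.1 x q.2) ⁻¹' (Set.pi (s : Set ℤ) t)
        = (Set.pi ((s.erase x : Finset ℤ) : Set ℤ) t) ×ˢ t x := by
      ext q
      simp only [Set.mem_preimage, Set.mem_pi, Finset.mem_coe, Set.mem_prod, Finset.mem_erase]
      constructor
      · intro h
        exact ⟨fun i hi => by simpa [hi.1] using h i hi.2, by simpa using h x hx⟩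
      · rintro ⟨h1, h2⟩ i hi
        by_cases hix : i = x
        · subst hix; simpa using h2
        · simpa [hix] using h1 i ⟨hix, hi⟩
    rw [this, Measure.prod_prod, chainMeasure, Measure.infinitePi_pi _ fun i _ => ht i,
      Finset.prod_erase_mul _ _ hx]
  · have : (fun q : Config × (ℝ × ℝ) => Function.update q.1 x q.2) ⁻¹' (Set.pi (s : Set ℤ) t)
        = (Set.pi (s : Set ℤ) t) ×ˢ Set.univ := by
      ext q
      simp only [Set.mem_preimage, Set.mem_pi, Finset.mem_coe, Set.mem_prod, Set.mem_univ,
        and_true]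
      refine forall₂_congr fun i hi => ?_
      rw [Function.update_of_ne (ne_of_mem_of_not_mem hi hx)]
    rw [this, Measure.prod_prod, measure_univ, mul_one, chainMeasure,
      Measure.infinitePi_pi _ fun i _ => ht i]

end ProductMeasure

/-- The measure `ρ` on the line satisfies the integration by parts formula `∫ η' dρ = ∫ b η dρ`. -/
def HasScore (ρ : Measure ℝ) (b : ℝ → ℝ) : Prop :=
  ∀ η : ℝ → ℝ, Differentiable ℝ η → Integrable η ρ → Integrable (deriv η) ρ →
    Integrable (fun s => b s * η s) ρ → ∫ s, deriv η s ∂ρ = ∫ s, b s * η s ∂ρ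

/-- `(w η)' = w (η' - b η)`, and an integrable function with integrable derivative has derivative of
integral zero; no decay at infinity has to be assumed. -/
theorem hasScore_withDensity {w b : ℝ → ℝ} (hw0 : ∀ s, 0 ≤ w s)
    (hw : ∀ s, HasDerivAt w (-(b s) * w s) s) :
    HasScore (volume.withDensity fun s => ENNReal.ofReal (w s)) b := by
  intro η hη h1 h2 h3
  have hwm : Measurable fun s => ENNReal.ofReal (w s) :=
    ENNReal.measurable_ofReal.comp
      (continuous_iff_continuousAt.2 fun s => (hw s).continuousAt).measurable
  have hlt : ∀ᵐ s, ENNReal.ofReal (w s) < ⊤ := Eventually.of_forall fun _ => ENNReal.ofReal_lt_top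
  rw [← sub_eq_zero, ← integral_sub h2 h3,
    integral_withDensity_eq_integral_toReal_smul hwm hlt]
  rw [integrable_withDensity_iff_integrable_smul' hwm hlt] at h1 h2 h3
  simp only [ENNReal.toReal_ofReal (hw0 _), smul_eq_mul] at h1 h2 h3 ⊢
  refine integral_eq_zero_of_hasDerivAt_of_integrable (f := fun s => w s * η s)
    (fun s => ?_) ((h2.sub h3).congr (Eventually.of_forall fun s => ?_)) h1
  · convert! (hw s).mul (hη s).hasDerivAt using 1
    ring
  · simp only [Pi.sub_apply]
    ring

theorem HasScore.integral_prod_fst {ρ τ : Measure ℝ} [SFinite ρ] [SFinite τ] {b : ℝ → ℝ}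
    (hb : HasScore ρ b) {η : ℝ × ℝ → ℝ} (hd : ∀ p, Differentiable ℝ fun s => η (s, p))
    (h1 : Integrable η (ρ.prod τ))
    (h2 : Integrable (fun z : ℝ × ℝ => deriv (fun s => η (s, z.2)) z.1) (ρ.prod τ))
    (h3 : Integrable (fun z : ℝ × ℝ => b z.1 * η z) (ρ.prod τ)) :
    ∫ z, deriv (fun s => η (s, z.2)) z.1 ∂(ρ.prod τ) = ∫ z, b z.1 * η z ∂(ρ.prod τ) := by
  rw [integral_prod_symm _ h2, integral_prod_symm _ h3]
  refine integral_congr_ae ?_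
  filter_upwards [h1.prod_left_ae, h2.prod_left_ae, h3.prod_left_ae] with p k1 k2 k3
  exact hb _ (hd p) k1 k2 k3

theorem HasScore.integral_prod_snd {ρ τ : Measure ℝ} [SFinite ρ] [SFinite τ] {b : ℝ → ℝ}
    (hb : HasScore τ b) {η : ℝ × ℝ → ℝ} (hd : ∀ r, Differentiable ℝ fun s => η (r, s))
    (h1 : Integrable η (ρ.prod τ))
    (h2 : Integrable (fun z : ℝ × ℝ => deriv (fun s => η (z.1, s)) z.2) (ρ.prod τ))
    (h3 : Integrable (fun z : ℝ × ℝ => b z.2 * η z) (ρ.prod τ)) :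
    ∫ z, deriv (fun s => η (z.1, s)) z.2 ∂(ρ.prod τ) = ∫ z, b z.2 * η z ∂(ρ.prod τ) := by
  rw [integral_prod _ h2, integral_prod _ h3]
  refine integral_congr_ae ?_
  filter_upwards [h1.prod_right_ae, h2.prod_right_ae, h3.prod_right_ae] with p k1 k2 k3
  exact hb _ (hd p) k1 k2 k3

theorem integral_resample {ν : Measure (ℝ × ℝ)} [IsProbabilityMeasure ν] (x : ℤ)
    {k : Config → ℝ} (hk : Integrable k (chainMeasure ν)) :
    (∀ᵐ ω ∂chainMeasure ν, Integrable (fun z => k (Function.update ω x z)) ν) ∧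
      ∫ ω, k ω ∂chainMeasure ν
        = ∫ ω, ∫ z, k (Function.update ω x z) ∂ν ∂chainMeasure ν := by
  have h := measurePreserving_resample (ν := ν) x
  have hi := h.integrable_comp_of_integrable hk
  refine ⟨hi.prod_right_ae, ?_⟩
  refine Eq.trans ?_ (integral_prod _ hi)
  conv_lhs => rw [← h.map_eq]
  rw [integral_map h.measurable.aemeasurable (by rw [h.map_eq]; exact hk.aestronglyMeasurable)]
  rfl

namespace OscillatorChain

variable (D : OscillatorChain)

theorem hasScore_tilted :
    HasScore (volume.tilted fun r => -D.V r / D.T) (fun r => deriv D.V r / D.T) := by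
  refine hasScore_withDensity (fun s => by positivity) fun s => ?_
  have hd : HasDerivAt D.V (deriv D.V s) s :=
    (D.smooth.differentiable (by simp)).differentiableAt.hasDerivAt
  convert! ((hd.neg.div_const D.T).exp.div_const _) using 1
  simp only [Pi.neg_apply]
  ring

theorem hasScore_gaussian : HasScore (gaussianReal 0 D.T.toNNReal) (fun p => p / D.T) := by
  have hT : D.T.toNNReal ≠ 0 := (Real.toNNReal_pos.2 D.T_pos).ne'
  rw [gaussianReal_of_var_ne_zero _ hT]
  refine hasScore_withDensity (fun s => gaussianPDFReal_nonneg _ _ _) fun s => ?_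
  have hT0 := D.T_pos.ne'
  have hd : HasDerivAt (fun x : ℝ => -(x - 0) ^ 2 / (2 * D.T)) (-(s / D.T)) s := by
    have := ((((hasDerivAt_id s).sub_const 0).pow 2).neg.div_const (2 * D.T))
    convert! this using 1
    simp
    field_simp
  unfold gaussianPDFReal
  rw [Real.coe_toNNReal _ D.T_pos.le]
  convert! hd.exp.const_mul _ using 1
  ring

theorem partialR_update (x : ℤ) (h : Config → ℝ) (ω : Config) (z : ℝ × ℝ) :
    partialR x h (Function.update ω x z)
      = deriv (fun s => h (Function.update ω x (s, z.2))) z.1 := by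
  simp [partialR]

theorem partialP_update (x : ℤ) (h : Config → ℝ) (ω : Config) (z : ℝ × ℝ) :
    partialP x h (Function.update ω x z)
      = deriv (fun s => h (Function.update ω x (z.1, s))) z.2 := by
  simp [partialP]

theorem integral_partialR (x : ℤ) {h : Config → ℝ}
    (hd : ∀ ω, Differentiable ℝ fun s => h (Function.update ω x (s, (ω x).2)))
    (h1 : Integrable h D.gibbs) (h2 : Integrable (partialR x h) D.gibbs)
    (h3 : Integrable (fun ω => deriv D.V (ω x).1 * h ω) D.gibbs) :
    ∫ ω, partialR x h ω ∂D.gibbs = (∫ ω, deriv D.V (ω x).1 * h ω ∂D.gibbs) / D.T := by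
  obtain ⟨a1, -⟩ := integral_resample x h1
  obtain ⟨a2, e2⟩ := integral_resample x h2
  obtain ⟨a3, e3⟩ := integral_resample x (h3.div_const D.T)
  rw [← integral_div, e2, e3]
  refine integral_congr_ae ?_
  filter_upwards [a1, a2, a3] with ω k1 k2 k3
  simp only [partialR_update, Function.update_self, mul_div_right_comm] at k2 k3 ⊢
  exact D.hasScore_tilted.integral_prod_fst (η := fun z => h (Function.update ω x z))
    -- The entry `0` is a dummy: the `r`-coordinate at `x` is overwritten by `s`.
    (fun p => by simpa using hd (Function.update ω x (0, p))) k1 k2 k3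

theorem integral_partialP (x : ℤ) {h : Config → ℝ}
    (hd : ∀ ω, Differentiable ℝ fun s => h (Function.update ω x ((ω x).1, s)))
    (h1 : Integrable h D.gibbs) (h2 : Integrable (partialP x h) D.gibbs)
    (h3 : Integrable (fun ω => (ω x).2 * h ω) D.gibbs) :
    ∫ ω, partialP x h ω ∂D.gibbs = (∫ ω, (ω x).2 * h ω ∂D.gibbs) / D.T := by
  obtain ⟨a1, -⟩ := integral_resample x h1
  obtain ⟨a2, e2⟩ := integral_resample x h2
  obtain ⟨a3, e3⟩ := integral_resample x (h3.div_const D.T)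
  rw [← integral_div, e2, e3]
  refine integral_congr_ae ?_
  filter_upwards [a1, a2, a3] with ω k1 k2 k3
  simp only [partialP_update, Function.update_self, mul_div_right_comm] at k2 k3 ⊢
  exact D.hasScore_gaussian.integral_prod_snd (η := fun z => h (Function.update ω x z))
    (fun p => by simpa using hd (Function.update ω x (p, 0))) k1 k2 k3

end OscillatorChain

/-! ### Shifts and momentum reversals -/

/-- All momenta are reversed. -/
def reversal (ω : Config) : Config := fun x => ((ω x).1, -(ω x).2)

theorem reversal_reversal (ω : Config) : reversal (reversal ω) = ω := by
  funext x; simp [reversal]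

theorem flipAt_flipAt (x : ℤ) (ω : Config) : flipAt x (flipAt x ω) = ω := by
  simp [flipAt]

theorem flipAt_eq_ite (x : ℤ) (ω : Config) :
    flipAt x ω = fun i => if i = x then ((ω i).1, -(ω i).2) else ω i := by
  funext i
  by_cases h : i = x
  · subst h; simp [flipAt]
  · simp [flipAt, h]

theorem flipAt_fst (x y : ℤ) (ω : Config) : (flipAt x ω y).1 = (ω y).1 := by
  rw [flipAt_eq_ite]; dsimp only; split_ifs <;> rfl

theorem flipAt_snd_self (x : ℤ) (ω : Config) : (flipAt x ω x).2 = -(ω x).2 := by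
  simp [flipAt]

theorem flipAt_of_ne {x y : ℤ} (h : y ≠ x) (ω : Config) : flipAt x ω y = ω y := by
  simp [flipAt, h]

theorem flipAt_comm (x y : ℤ) (ω : Config) : flipAt x (flipAt y ω) = flipAt y (flipAt x ω) := by
  simp only [flipAt_eq_ite]
  funext i
  split_ifs <;> rfl

theorem reversal_update (ω : Config) (y : ℤ) (a : ℝ × ℝ) :
    reversal (Function.update ω y a) = Function.update (reversal ω) y (a.1, -a.2) := by
  funext i
  by_cases h : i = y
  · subst h; simp [reversal]
  · simp [reversal, h]

theorem reversal_flipAt (x : ℤ) (ω : Config) :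
    reversal (flipAt x ω) = flipAt x (reversal ω) := by
  rw [flipAt, reversal_update, flipAt]
  simp [reversal]

theorem shift_update (x : ℤ) (ω : Config) (y : ℤ) (a : ℝ × ℝ) :
    shift x (Function.update ω y a) = Function.update (shift x ω) (y - x) a := by
  funext i
  by_cases h : i = y - x
  · subst h; simp [shift]
  · have : x + i ≠ y := fun h' => h (by omega)
    simp [shift, h, this]

theorem shift_flipAt (x y : ℤ) (ω : Config) :
    shift x (flipAt y ω) = flipAt (y - x) (shift x ω) := by
  rw [flipAt, shift_update, flipAt]
  simp [shift]

theorem shift_reversal (x : ℤ) (ω : Config) : shift x (reversal ω) = reversal (shift x ω) := rfl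

theorem partialR_comp_shift (x y : ℤ) (g : Config → ℝ) (ω : Config) :
    OscillatorChain.partialR y (fun ω => g (shift x ω)) ω
      = OscillatorChain.partialR (y - x) g (shift x ω) := by
  simp [OscillatorChain.partialR, shift_update, shift]

theorem partialP_comp_shift (x y : ℤ) (g : Config → ℝ) (ω : Config) :
    OscillatorChain.partialP y (fun ω => g (shift x ω)) ω
      = OscillatorChain.partialP (y - x) g (shift x ω) := by
  simp [OscillatorChain.partialP, shift_update, shift]

theorem partialR_comp_reversal (y : ℤ) (g : Config → ℝ) (ω : Config) :
    OscillatorChain.partialR y (fun ω => g (reversal ω)) ω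
      = OscillatorChain.partialR y g (reversal ω) := by
  simp only [OscillatorChain.partialR, reversal_update]
  rfl

theorem partialP_comp_reversal (y : ℤ) (g : Config → ℝ) (ω : Config) :
    OscillatorChain.partialP y (fun ω => g (reversal ω)) ω
      = -OscillatorChain.partialP y g (reversal ω) := by
  simp only [OscillatorChain.partialP, reversal_update]
  exact deriv_comp_neg (fun s => g (Function.update (reversal ω) y ((ω y).1, s))) (ω y).2

theorem partialR_eq_zero {f : Config → ℝ} {Λ : Finset ℤ} (hf : DependsOn f (Λ : Set ℤ))
    {x : ℤ} (hx : x ∉ Λ) (ω : Config) : OscillatorChain.partialR x f ω = 0 := by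
  have (s : ℝ) : f (Function.update ω x (s, (ω x).2)) = f ω :=
    hf fun i hi => Function.update_of_ne (ne_of_mem_of_not_mem (Finset.mem_coe.1 hi) hx) _ _
  simp [OscillatorChain.partialR, this]

theorem partialP_eq_zero {f : Config → ℝ} {Λ : Finset ℤ} (hf : DependsOn f (Λ : Set ℤ))
    {x : ℤ} (hx : x ∉ Λ) (ω : Config) : OscillatorChain.partialP x f ω = 0 := by
  have (s : ℝ) : f (Function.update ω x ((ω x).1, s)) = f ω :=
    hf fun i hi => Function.update_of_ne (ne_of_mem_of_not_mem (Finset.mem_coe.1 hi) hx) _ _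
  simp [OscillatorChain.partialP, this]

theorem comp_flipAt_eq {f : Config → ℝ} {Λ : Finset ℤ} (hf : DependsOn f (Λ : Set ℤ))
    {x : ℤ} (hx : x ∉ Λ) (ω : Config) : f (flipAt x ω) = f ω :=
  hf fun _ hi => Function.update_of_ne (ne_of_mem_of_not_mem (Finset.mem_coe.1 hi) hx) _ _

theorem noise_eq_sum {f : Config → ℝ} {Λ : Finset ℤ} (hf : DependsOn f (Λ : Set ℤ))
    (ω : Config) : OscillatorChain.noise f ω = ∑ x ∈ Λ, (f (flipAt x ω) - f ω) := by
  refine finsum_eq_sum_of_support_subset _ fun x hx => ?_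
  by_contra hcon
  exact hx (sub_eq_zero.2 (comp_flipAt_eq hf hcon ω))

theorem noise_comp_shift (x : ℤ) (f : Config → ℝ) (ω : Config) :
    OscillatorChain.noise (fun ω => f (shift x ω)) ω = OscillatorChain.noise f (shift x ω) := by
  unfold OscillatorChain.noise
  rw [← finsum_comp_equiv (Equiv.addLeft x)]
  refine finsum_congr fun y => ?_
  simp [shift_flipAt]

theorem noise_comp_reversal (f : Config → ℝ) (ω : Config) :
    OscillatorChain.noise (fun ω => f (reversal ω)) ω = OscillatorChain.noise f (reversal ω) := by
  simp only [OscillatorChain.noise, reversal_flipAt]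

theorem IsLocal.comp_shift {f : Config → ℝ} (hf : IsLocal f) (x : ℤ) :
    IsLocal fun ω => f (shift x ω) := by
  obtain ⟨Λ, hΛ⟩ := hf
  exact ⟨Λ.map (addLeftEmbedding x), fun a b h => hΛ fun i hi => h (x + i) (by simpa using hi)⟩

theorem DependsOn.comp_reversal {f : Config → ℝ} {A : Set ℤ} (hf : DependsOn f A) :
    DependsOn (fun ω => f (reversal ω)) A :=
  fun a b h => hf fun i hi => by simp [reversal, h i hi]

theorem DependsOn.comp_flipAt {f : Config → ℝ} {A : Set ℤ} (hf : DependsOn f A) (x : ℤ) :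
    DependsOn (fun ω => f (flipAt x ω)) A :=
  fun a b h => hf fun i hi => by simp [flipAt_eq_ite, h i hi]

theorem DependsOn.mul_union {f g : Config → ℝ} {A B : Finset ℤ} (hf : DependsOn f (A : Set ℤ))
    (hg : DependsOn g (B : Set ℤ)) : DependsOn (fun ω => f ω * g ω) ((A ∪ B : Finset ℤ) : Set ℤ) :=
  fun a b h => congr_arg₂ (· * ·) (hf fun i hi => h i (by simp [Finset.mem_coe.1 hi]))
    (hg fun i hi => h i (by simp [Finset.mem_coe.1 hi]))

namespace OscillatorChain

variable (D : OscillatorChain)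

theorem liouville_eq_sum {f : Config → ℝ} {Λ : Finset ℤ} (hf : DependsOn f (Λ : Set ℤ))
    (ω : Config) : D.liouville f ω = ∑ x ∈ Λ, (((ω x).2 - (ω (x - 1)).2) * partialR x f ω
      + (deriv D.V (ω (x + 1)).1 - deriv D.V (ω x).1) * partialP x f ω) := by
  refine finsum_eq_sum_of_support_subset _ fun x hx => ?_
  by_contra hcon
  refine hx ?_
  simp only
  rw [partialR_eq_zero hf hcon, partialP_eq_zero hf hcon]
  ring

theorem liouville_comp_shift (x : ℤ) (f : Config → ℝ) (ω : Config) :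
    D.liouville (fun ω => f (shift x ω)) ω = D.liouville f (shift x ω) := by
  unfold liouville
  rw [← finsum_comp_equiv (Equiv.addLeft x)]
  refine finsum_congr fun y => ?_
  simp [partialR_comp_shift, partialP_comp_shift, shift, add_assoc, add_sub_assoc]

theorem liouville_comp_reversal (f : Config → ℝ) (ω : Config) :
    D.liouville (fun ω => f (reversal ω)) ω = -D.liouville f (reversal ω) := by
  unfold liouville
  rw [← finsum_neg_distrib]
  refine finsum_congr fun y => ?_
  simp only [partialR_comp_reversal, partialP_comp_reversal, reversal]
  ring

theorem measurePreserving_site_neg :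
    MeasurePreserving (fun z : ℝ × ℝ => (z.1, -z.2)) D.site D.site := by
  refine (MeasurePreserving.id _).prod ⟨measurable_neg, ?_⟩
  change Measure.map (fun x => -x) _ = _
  rw [gaussianReal_map_neg, neg_zero]

theorem measurePreserving_reversal : MeasurePreserving reversal D.gibbs D.gibbs :=
  measurePreserving_sitewise fun _ => D.measurePreserving_site_neg

theorem measurePreserving_flipAt (x : ℤ) : MeasurePreserving (flipAt x) D.gibbs D.gibbs := by
  have h := measurePreserving_sitewise (ν := D.site)
    (φ := fun i => if i = x then fun z => (z.1, -z.2) else id) fun i => by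
      split_ifs
      · exact D.measurePreserving_site_neg
      · exact MeasurePreserving.id _
  convert h using 1
  funext ω i
  rw [flipAt_eq_ite]
  dsimp only
  split_ifs <;> rfl

theorem integral_comp_flipAt (x : ℤ) (k : Config → ℝ) :
    ∫ ω, k (flipAt x ω) ∂D.gibbs = ∫ ω, k ω ∂D.gibbs :=
  MeasurePreserving.integral_comp' (f := MeasurableEquiv.ofInvolutive (flipAt x)
    (flipAt_flipAt x) (D.measurePreserving_flipAt x).measurable) (D.measurePreserving_flipAt x) k

theorem integral_comp_reversal (k : Config → ℝ) :
    ∫ ω, k (reversal ω) ∂D.gibbs = ∫ ω, k ω ∂D.gibbs :=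
  MeasurePreserving.integral_comp' (f := MeasurableEquiv.ofInvolutive reversal
    reversal_reversal D.measurePreserving_reversal.measurable) D.measurePreserving_reversal k

/-- This parity argument removes the boundary terms in `integral_liouville` and all terms but one in
`inner_symmCurrent_self`. -/
theorem integral_eq_zero_of_flipAt {x : ℤ} {k : Config → ℝ} (hk : ∀ ω, k (flipAt x ω) = -k ω) :
    ∫ ω, k ω ∂D.gibbs = 0 := by
  have h := D.integral_comp_flipAt x k
  simp only [hk, integral_neg] at h
  linarith

theorem memLp_momentum_at (x : ℤ) {q : ENNReal} (hq : q ≠ ⊤) :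
    MemLp (fun ω : Config => (ω x).2) q D.gibbs := by
  have h1 : MemLp (id : ℝ → ℝ) q (gaussianReal 0 D.T.toNNReal) := memLp_id_gaussianReal' q hq
  have h2 : MemLp (fun z : ℝ × ℝ => z.2) q D.site :=
    h1.comp_measurePreserving measurePreserving_snd
  exact h2.comp_measurePreserving (measurePreserving_eval_infinitePi (fun _ : ℤ => D.site) x)

theorem memLp_force_at (x : ℤ) : MemLp (fun ω : Config => deriv D.V (ω x).1) 2 D.gibbs := by
  have h := D.memLp_force.comp_measurePreserving (measurePreserving_shift D.site (x - 1))
  simpa [Function.comp_def, shift] using h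

end OscillatorChain

/-! ### Antisymmetry of the Liouville operator -/

namespace OscillatorChain

variable (D : OscillatorChain)

/-- Local functions that are differentiable in every coordinate and have, together with their
partial derivatives, moments of all orders. -/
structure IsSmoothObservable (f : Config → ℝ) : Prop where
  isLocal : IsLocal f
  differentiableR : ∀ x ω, Differentiable ℝ fun s => f (Function.update ω x (s, (ω x).2))
  differentiableP : ∀ x ω, Differentiable ℝ fun s => f (Function.update ω x ((ω x).1, s))
  memLp : ∀ q : ENNReal, q ≠ ⊤ → MemLp f q D.gibbs
  memLpR : ∀ (x : ℤ) (q : ENNReal), q ≠ ⊤ → MemLp (partialR x f) q D.gibbs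
  memLpP : ∀ (x : ℤ) (q : ENNReal), q ≠ ⊤ → MemLp (partialP x f) q D.gibbs

theorem partialR_mul {f g : Config → ℝ} {x : ℤ} {ω : Config}
    (hf : Differentiable ℝ fun s => f (Function.update ω x (s, (ω x).2)))
    (hg : Differentiable ℝ fun s => g (Function.update ω x (s, (ω x).2))) :
    partialR x (fun ω => f ω * g ω) ω = partialR x f ω * g ω + f ω * partialR x g ω := by
  unfold partialR
  rw [deriv_fun_mul (hf _) (hg _)]
  simp

theorem partialP_mul {f g : Config → ℝ} {x : ℤ} {ω : Config}
    (hf : Differentiable ℝ fun s => f (Function.update ω x ((ω x).1, s)))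
    (hg : Differentiable ℝ fun s => g (Function.update ω x ((ω x).1, s))) :
    partialP x (fun ω => f ω * g ω) ω = partialP x f ω * g ω + f ω * partialP x g ω := by
  unfold partialP
  rw [deriv_fun_mul (hf _) (hg _)]
  simp

theorem _root_.MeasureTheory.MemLp.mul_two_mul {α : Type*} [MeasurableSpace α] {μ : Measure α}
    {f g : α → ℝ} {q : ENNReal} (hf : MemLp f (2 * q) μ) (hg : MemLp g (2 * q) μ) :
    MemLp (fun a => f a * g a) q μ := by
  have : ENNReal.HolderTriple (2 * q) (2 * q) q := ⟨by
    rw [ENNReal.mul_inv (Or.inl two_ne_zero) (Or.inl ENNReal.ofNat_ne_top), ← add_mul,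
      ENNReal.inv_two_add_inv_two, one_mul]⟩
  exact MemLp.mul' hg hf

variable {D}

namespace IsSmoothObservable

variable {f g : Config → ℝ}

/-- Hölder doubles the exponent, so closure under products is the reason for demanding all finite
moments. Boundedness would be too strong, since the class has to contain `p_0²/2`. -/
theorem mul (hf : D.IsSmoothObservable f) (hg : D.IsSmoothObservable g) :
    D.IsSmoothObservable fun ω => f ω * g ω where
  isLocal := by
    obtain ⟨A, hA⟩ := hf.isLocal
    obtain ⟨B, hB⟩ := hg.isLocal
    exact ⟨_, DependsOn.mul_union hA hB⟩
  differentiableR x ω := (hf.differentiableR x ω).mul (hg.differentiableR x ω)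
  differentiableP x ω := (hf.differentiableP x ω).mul (hg.differentiableP x ω)
  memLp q hq :=
    have h2 : 2 * q ≠ ⊤ := ENNReal.mul_ne_top ENNReal.ofNat_ne_top hq
    (hf.memLp _ h2).mul_two_mul (hg.memLp _ h2)
  memLpR x q hq := by
    have h2 : 2 * q ≠ ⊤ := ENNReal.mul_ne_top ENNReal.ofNat_ne_top hq
    refine (((hf.memLpR x _ h2).mul_two_mul (hg.memLp _ h2)).add
      ((hf.memLp _ h2).mul_two_mul (hg.memLpR x _ h2))).ae_eq (Eventually.of_forall fun ω => ?_)
    exact (partialR_mul (hf.differentiableR x ω) (hg.differentiableR x ω)).symm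
  memLpP x q hq := by
    have h2 : 2 * q ≠ ⊤ := ENNReal.mul_ne_top ENNReal.ofNat_ne_top hq
    refine (((hf.memLpP x _ h2).mul_two_mul (hg.memLp _ h2)).add
      ((hf.memLp _ h2).mul_two_mul (hg.memLpP x _ h2))).ae_eq (Eventually.of_forall fun ω => ?_)
    exact (partialP_mul (hf.differentiableP x ω) (hg.differentiableP x ω)).symm

theorem comp_shift (hf : D.IsSmoothObservable f) (x : ℤ) :
    D.IsSmoothObservable fun ω => f (shift x ω) where
  isLocal := hf.isLocal.comp_shift x
  differentiableR y ω := by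
    simp only [shift_update]
    simpa [shift] using hf.differentiableR (y - x) (shift x ω)
  differentiableP y ω := by
    simp only [shift_update]
    simpa [shift] using hf.differentiableP (y - x) (shift x ω)
  memLp q hq := (hf.memLp q hq).comp_measurePreserving (measurePreserving_shift D.site x)
  memLpR y q hq := by
    have := (hf.memLpR (y - x) q hq).comp_measurePreserving (measurePreserving_shift D.site x)
    exact this.ae_eq (Eventually.of_forall fun ω => (partialR_comp_shift x y f ω).symm)
  memLpP y q hq := by
    have := (hf.memLpP (y - x) q hq).comp_measurePreserving (measurePreserving_shift D.site x)
    exact this.ae_eq (Eventually.of_forall fun ω => (partialP_comp_shift x y f ω).symm)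

theorem comp_reversal (hf : D.IsSmoothObservable f) :
    D.IsSmoothObservable fun ω => f (reversal ω) where
  isLocal := hf.isLocal.imp fun _ h => h.comp_reversal
  differentiableR y ω := by
    simp only [reversal_update]
    exact hf.differentiableR y (reversal ω)
  differentiableP y ω := by
    simp only [reversal_update]
    exact (hf.differentiableP y (reversal ω)).comp differentiable_neg
  memLp q hq := (hf.memLp q hq).comp_measurePreserving D.measurePreserving_reversal
  memLpR y q hq := by
    have := (hf.memLpR y q hq).comp_measurePreserving D.measurePreserving_reversal
    exact this.ae_eq (Eventually.of_forall fun ω => (partialR_comp_reversal y f ω).symm)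
  memLpP y q hq := by
    have := (hf.memLpP y q hq).neg.comp_measurePreserving D.measurePreserving_reversal
    exact this.ae_eq (Eventually.of_forall fun ω => (partialP_comp_reversal y f ω).symm)

theorem integrable_momentum_mul_force (hf : D.IsSmoothObservable f) (x y : ℤ) :
    Integrable (fun ω : Config => (ω x).2 * deriv D.V (ω y).1 * f ω) D.gibbs := by
  have h4 : (2 : ENNReal) * 2 ≠ ⊤ := ENNReal.mul_ne_top ENNReal.ofNat_ne_top ENNReal.ofNat_ne_top
  have h := (D.memLp_force_at y).integrable_mul
    ((D.memLp_momentum_at x h4).mul_two_mul (hf.memLp _ h4))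
  refine h.congr (Eventually.of_forall fun ω => ?_)
  simp only [Pi.mul_apply]
  ring

theorem integrable_mul_momentum {a : Config → ℝ} (ha : MemLp a 2 D.gibbs) (x : ℤ) :
    Integrable (fun ω : Config => (ω x).2 * a ω) D.gibbs :=
  (D.memLp_momentum_at x (q := 2) ENNReal.ofNat_ne_top).integrable_mul ha

theorem integrable_mul_force {a : Config → ℝ} (ha : MemLp a 2 D.gibbs) (x : ℤ) :
    Integrable (fun ω : Config => deriv D.V (ω x).1 * a ω) D.gibbs :=
  (D.memLp_force_at x).integrable_mul ha

theorem integral_momentum_mul_partialR (hf : D.IsSmoothObservable f) (x y : ℤ) :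
    Integrable (fun ω : Config => (ω y).2 * partialR x f ω) D.gibbs ∧
    ∫ ω, (ω y).2 * partialR x f ω ∂D.gibbs
      = (∫ ω, (ω y).2 * deriv D.V (ω x).1 * f ω ∂D.gibbs) / D.T := by
  have hsnd (ω : Config) (s : ℝ) : (Function.update ω x (s, (ω x).2) y).2 = (ω y).2 := by
    by_cases h : y = x
    · subst h; simp
    · simp [h]
  have hpart : partialR x (fun ω => (ω y).2 * f ω) = fun ω => (ω y).2 * partialR x f ω := by
    funext ω
    simp only [partialR, hsnd]
    rw [deriv_const_mul _ (hf.differentiableR x ω _)]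
  have hi := integrable_mul_momentum (hf.memLpR x 2 ENNReal.ofNat_ne_top) y
  refine ⟨hi, ?_⟩
  have h := D.integral_partialR x (h := fun ω => (ω y).2 * f ω)
    (fun ω => by simpa only [hsnd] using (hf.differentiableR x ω).const_mul _)
    (integrable_mul_momentum (hf.memLp 2 ENNReal.ofNat_ne_top) y) (by rw [hpart]; exact hi)
    ((hf.integrable_momentum_mul_force y x).congr (Eventually.of_forall fun ω => by ring))
  rw [hpart] at h
  rw [h]
  congr 2
  funext ω
  ring

/-- The force does not depend on `p_x`, so it can be moved inside the derivative; `V''` never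
appears and `V' ∈ L²` is enough. -/
theorem integral_force_mul_partialP (hf : D.IsSmoothObservable f) (x y : ℤ) :
    Integrable (fun ω : Config => deriv D.V (ω y).1 * partialP x f ω) D.gibbs ∧
    ∫ ω, deriv D.V (ω y).1 * partialP x f ω ∂D.gibbs
      = (∫ ω, (ω x).2 * deriv D.V (ω y).1 * f ω ∂D.gibbs) / D.T := by
  have hfst (ω : Config) (s : ℝ) : (Function.update ω x ((ω x).1, s) y).1 = (ω y).1 := by
    by_cases h : y = x
    · subst h; simp
    · simp [h]
  have hpart : partialP x (fun ω => deriv D.V (ω y).1 * f ω)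
      = fun ω => deriv D.V (ω y).1 * partialP x f ω := by
    funext ω
    simp only [partialP, hfst]
    rw [deriv_const_mul _ (hf.differentiableP x ω _)]
  have hi := integrable_mul_force (hf.memLpP x 2 ENNReal.ofNat_ne_top) y
  refine ⟨hi, ?_⟩
  have h := D.integral_partialP x (h := fun ω => deriv D.V (ω y).1 * f ω)
    (fun ω => by simpa only [hfst] using (hf.differentiableP x ω).const_mul _)
    (integrable_mul_force (hf.memLp 2 ENNReal.ofNat_ne_top) y) (by rw [hpart]; exact hi)
    ((hf.integrable_momentum_mul_force x y).congr (Eventually.of_forall fun ω => by ring))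
  rw [hpart] at h
  rw [h]
  congr 2
  funext ω
  ring

/-- The Gibbs measure is invariant under the Hamiltonian dynamics. -/
theorem integral_liouville (hf : D.IsSmoothObservable f) : ∫ ω, D.liouville f ω ∂D.gibbs = 0 := by
  obtain ⟨Λ, hΛ⟩ := hf.isLocal
  -- Integrating by parts, the terms with `p_x V'(r_x)` cancel within each site and what remains is
  -- the telescoping difference `(c (x + 1) - c x) / T`.
  set c : ℤ → ℝ := fun x => ∫ ω, (ω (x - 1)).2 * deriv D.V (ω x).1 * f ω ∂D.gibbs with hc
  have hc0 (x : ℤ) (hx : x - 1 ∉ Λ) : c x = 0 := by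
    refine D.integral_eq_zero_of_flipAt (x := x - 1) fun ω => ?_
    rw [flipAt_snd_self, flipAt_fst, comp_flipAt_eq hΛ hx]
    ring
  have hterm (x : ℤ) : Integrable (fun ω : Config => ((ω x).2 - (ω (x - 1)).2) * partialR x f ω
      + (deriv D.V (ω (x + 1)).1 - deriv D.V (ω x).1) * partialP x f ω) D.gibbs ∧
      ∫ ω, (((ω x).2 - (ω (x - 1)).2) * partialR x f ω
      + (deriv D.V (ω (x + 1)).1 - deriv D.V (ω x).1) * partialP x f ω) ∂D.gibbs
      = (c (x + 1) - c x) / D.T := by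
    obtain ⟨i1, e1⟩ := hf.integral_momentum_mul_partialR x x
    obtain ⟨i2, e2⟩ := hf.integral_momentum_mul_partialR x (x - 1)
    obtain ⟨i3, e3⟩ := hf.integral_force_mul_partialP x (x + 1)
    obtain ⟨i4, e4⟩ := hf.integral_force_mul_partialP x x
    simp only [sub_mul]
    refine ⟨(i1.sub i2).add (i3.sub i4), ?_⟩
    refine (integral_add (i1.sub i2) (i3.sub i4)).trans ?_
    simp only [Pi.sub_apply]
    rw [integral_sub i1 i2, integral_sub i3 i4, e1, e2, e3, e4]
    simp only [hc, add_sub_cancel_right]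
    ring
  simp only [D.liouville_eq_sum hΛ]
  rw [integral_finsetSum _ fun x _ => (hterm x).1]
  simp only [(hterm _).2]
  have hsupp : (Function.support c).Finite := by
    refine (Λ.image (· + 1)).finite_toSet.subset fun x hx => ?_
    by_contra hcon
    exact hx (hc0 x fun h => hcon (by simpa [← sub_eq_add_neg] using h))
  have hsupp' : (Function.support fun x => c (x + 1)).Finite :=
    hsupp.preimage (add_left_injective 1).injOn
  rw [← Finset.sum_div]
  -- Off `Λ` both partial derivatives of `f` vanish, so `hterm` itself gives `c (x + 1) = c x`
  -- there.
  have hfin : ∑ x ∈ Λ, (c (x + 1) - c x) = ∑ᶠ x, (c (x + 1) - c x) := by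
    refine (finsum_eq_sum_of_support_subset _ fun x hx => ?_).symm
    by_contra hcon
    refine hx ?_
    have h := (hterm x).2
    have h0 (ω : Config) : partialR x f ω = 0 := partialR_eq_zero hΛ hcon ω
    have h1 (ω : Config) : partialP x f ω = 0 := partialP_eq_zero hΛ hcon ω
    simp only [h0, h1, mul_zero, add_zero, integral_zero] at h
    have := D.T_pos.ne'
    field_simp at h
    simpa using h.symm
  have hshift : ∑ᶠ x, c (x + 1) = ∑ᶠ x, c x := finsum_comp_equiv (Equiv.addRight (1 : ℤ))
  rw [hfin, finsum_sub_distrib hsupp' hsupp, hshift, sub_self, zero_div]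

theorem liouville_mul (hf : D.IsSmoothObservable f) (hg : D.IsSmoothObservable g) (ω : Config) :
    D.liouville (fun ω => f ω * g ω) ω = D.liouville f ω * g ω + f ω * D.liouville g ω := by
  obtain ⟨A, hA⟩ := hf.isLocal
  obtain ⟨B, hB⟩ := hg.isLocal
  have hA' : DependsOn f ((A ∪ B : Finset ℤ) : Set ℤ) :=
    fun a b h => hA fun i hi => h i (by simp [Finset.mem_coe.1 hi])
  have hB' : DependsOn g ((A ∪ B : Finset ℤ) : Set ℤ) :=
    fun a b h => hB fun i hi => h i (by simp [Finset.mem_coe.1 hi])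
  rw [D.liouville_eq_sum (DependsOn.mul_union hA hB), D.liouville_eq_sum hA',
    D.liouville_eq_sum hB', Finset.sum_mul, Finset.mul_sum, ← Finset.sum_add_distrib]
  refine Finset.sum_congr rfl fun x _ => ?_
  rw [partialR_mul (hf.differentiableR x ω) (hg.differentiableR x ω),
    partialP_mul (hf.differentiableP x ω) (hg.differentiableP x ω)]
  ring

theorem integrable_liouville_mul (hf : D.IsSmoothObservable f) (hg : D.IsSmoothObservable g) :
    Integrable (fun ω => D.liouville f ω * g ω) D.gibbs := by
  obtain ⟨Λ, hΛ⟩ := hf.isLocal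
  simp only [D.liouville_eq_sum hΛ, Finset.sum_mul]
  have h4 : (2 : ENNReal) * 2 ≠ ⊤ := ENNReal.mul_ne_top ENNReal.ofNat_ne_top ENNReal.ofNat_ne_top
  refine integrable_finsetSum _ fun x _ => ?_
  have hr := (hf.memLpR x _ h4).mul_two_mul (hg.memLp _ h4)
  have hp := (hf.memLpP x _ h4).mul_two_mul (hg.memLp _ h4)
  refine (((integrable_mul_momentum hr x).sub (integrable_mul_momentum hr (x - 1))).add
    ((integrable_mul_force hp (x + 1)).sub (integrable_mul_force hp x))).congr
    (Eventually.of_forall fun ω => ?_)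
  simp only [Pi.add_apply, Pi.sub_apply]
  ring

/-- Invariance of the measure applied to `f g`, with the Leibniz rule. -/
theorem integral_mul_liouville (hf : D.IsSmoothObservable f) (hg : D.IsSmoothObservable g) :
    ∫ ω, f ω * D.liouville g ω ∂D.gibbs = -∫ ω, D.liouville f ω * g ω ∂D.gibbs := by
  have h := (hf.mul hg).integral_liouville
  simp only [hf.liouville_mul hg] at h
  rw [integral_add (hf.integrable_liouville_mul hg)
    ((hg.integrable_liouville_mul hf).congr (Eventually.of_forall fun ω => mul_comm _ _))] at h
  linarith

theorem fluct_liouville (hf : D.IsSmoothObservable f) (hg : D.IsSmoothObservable g) :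
    fluct D.site f (D.liouville g) = -fluct D.site (D.liouville f) g := by
  unfold fluct
  rw [← finsum_neg_distrib]
  refine finsum_congr fun x => ?_
  rw [hf.integral_liouville, hg.integral_liouville]
  simp only [← D.liouville_comp_shift]
  rw [hf.integral_mul_liouville (hg.comp_shift x)]
  ring

end IsSmoothObservable

end OscillatorChain

/-! ### The noise operator -/

namespace LocalFn

variable {ν : Measure (ℝ × ℝ)} [IsProbabilityMeasure ν]

@[ext] theorem ext {f g : LocalFn ν} (h : ∀ ω, f.fn ω = g.fn ω) : f = g :=
  Subtype.ext (funext h)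

theorem fn_add (f g : LocalFn ν) (ω : Config) : (f + g).fn ω = f.fn ω + g.fn ω := rfl

theorem fn_sub (f g : LocalFn ν) (ω : Config) : (f - g).fn ω = f.fn ω - g.fn ω := rfl

theorem fn_neg (f : LocalFn ν) (ω : Config) : (-f).fn ω = -f.fn ω := rfl

theorem fn_smul (c : ℝ) (f : LocalFn ν) (ω : Config) : (c • f).fn ω = c * f.fn ω := rfl

theorem inner_eq_fluct (f g : LocalFn ν) : inner ℝ f g = fluct ν f.fn g.fn := rfl

end LocalFn

namespace OscillatorChain

variable (D : OscillatorChain)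

theorem comp_flipAt_mem {f : Config → ℝ} (hf : f ∈ localSubmodule D.site) (x : ℤ) :
    (fun ω => f (flipAt x ω)) ∈ localSubmodule D.site :=
  ⟨hf.1.imp fun _ h => h.comp_flipAt x, hf.2.1.comp (D.measurePreserving_flipAt x).measurable,
    hf.2.2.comp_measurePreserving (D.measurePreserving_flipAt x)⟩

theorem comp_reversal_mem {f : Config → ℝ} (hf : f ∈ localSubmodule D.site) :
    (fun ω => f (reversal ω)) ∈ localSubmodule D.site :=
  ⟨hf.1.imp fun _ h => h.comp_reversal, hf.2.1.comp D.measurePreserving_reversal.measurable,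
    hf.2.2.comp_measurePreserving D.measurePreserving_reversal⟩

theorem noise_mem {f : Config → ℝ} (hf : f ∈ localSubmodule D.site) :
    noise f ∈ localSubmodule D.site := by
  obtain ⟨Λ, hΛ⟩ := hf.1
  have h : noise f = ∑ x ∈ Λ, ((fun ω => f (flipAt x ω)) - f) := by
    funext ω
    rw [noise_eq_sum hΛ, Finset.sum_apply]
    rfl
  rw [h]
  exact sum_mem fun x _ => sub_mem (D.comp_flipAt_mem hf x) hf

theorem integral_noise {f : Config → ℝ} (hf : f ∈ localSubmodule D.site) :
    ∫ ω, noise f ω ∂D.gibbs = 0 := by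
  obtain ⟨Λ, hΛ⟩ := hf.1
  have hi {g : Config → ℝ} (hg : g ∈ localSubmodule D.site) : Integrable g D.gibbs :=
    hg.2.2.integrable one_le_two
  have i1 (x : ℤ) : Integrable (fun ω => f (flipAt x ω) - f ω) D.gibbs :=
    (hi (D.comp_flipAt_mem hf x)).sub (hi hf)
  simp only [noise_eq_sum hΛ]
  rw [integral_finsetSum _ fun x _ => i1 x]
  refine Finset.sum_eq_zero fun x _ => ?_
  rw [integral_sub (hi (D.comp_flipAt_mem hf x)) (hi hf), D.integral_comp_flipAt, sub_self]

theorem integral_mul_noise {f g : Config → ℝ} (hf : f ∈ localSubmodule D.site)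
    (hg : g ∈ localSubmodule D.site) :
    ∫ ω, f ω * noise g ω ∂D.gibbs = ∫ ω, noise f ω * g ω ∂D.gibbs := by
  obtain ⟨A, hA⟩ := hf.1
  obtain ⟨B, hB⟩ := hg.1
  have hA' : DependsOn f ((A ∪ B : Finset ℤ) : Set ℤ) :=
    fun a b h => hA fun i hi => h i (by simp [Finset.mem_coe.1 hi])
  have hB' : DependsOn g ((A ∪ B : Finset ℤ) : Set ℤ) :=
    fun a b h => hB fun i hi => h i (by simp [Finset.mem_coe.1 hi])
  have hi {f g : Config → ℝ} (hf : f ∈ localSubmodule D.site) (hg : g ∈ localSubmodule D.site) :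
      Integrable (fun ω => f ω * g ω) D.gibbs := hf.2.2.integrable_mul hg.2.2
  simp only [noise_eq_sum hA', noise_eq_sum hB', Finset.mul_sum, Finset.sum_mul, mul_sub, sub_mul]
  have i1 (x : ℤ) := hi hf (D.comp_flipAt_mem hg x)
  have i2 (x : ℤ) := hi (D.comp_flipAt_mem hf x) hg
  have i3 := hi hf hg
  have i4 (x : ℤ) : Integrable (fun ω => f ω * g (flipAt x ω) - f ω * g ω) D.gibbs :=
    (i1 x).sub i3
  have i5 (x : ℤ) : Integrable (fun ω => f (flipAt x ω) * g ω - f ω * g ω) D.gibbs :=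
    (i2 x).sub i3
  rw [integral_finsetSum _ fun x _ => i4 x, integral_finsetSum _ fun x _ => i5 x]
  refine Finset.sum_congr rfl fun x _ => ?_
  rw [integral_sub (i1 x) i3, integral_sub (i2 x) i3,
    ← D.integral_comp_flipAt x fun ω => f (flipAt x ω) * g ω]
  simp only [flipAt_flipAt]

/-- Each flip is a measure-preserving involution, and the noise commutes with shifts and has mean
zero, so symmetry holds term by term in the sum over shifts. -/
theorem fluct_noise {f g : Config → ℝ} (hf : f ∈ localSubmodule D.site)
    (hg : g ∈ localSubmodule D.site) : fluct D.site f (noise g) = fluct D.site (noise f) g := by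
  unfold fluct
  refine finsum_congr fun x => ?_
  have hgx : (fun ω => g (shift x ω)) ∈ localSubmodule D.site :=
    ⟨hg.1.comp_shift x, hg.2.1.comp (measurable_shift x), memLp_shift hg x⟩
  rw [D.integral_noise hf, D.integral_noise hg]
  simp only [← noise_comp_shift]
  rw [D.integral_mul_noise hf hgx]
  ring

/-- The reversal of one momentum, acting on local functions. -/
def flipLin (x : ℤ) : LocalFn D.site →ₗ[ℝ] LocalFn D.site where
  toFun f := ⟨fun ω => f.fn (flipAt x ω), D.comp_flipAt_mem f.2 x⟩
  map_add' _ _ := rfl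
  map_smul' _ _ := rfl

/-- The reversal of all momenta, acting on local functions. -/
def reversalLin : LocalFn D.site →ₗ[ℝ] LocalFn D.site where
  toFun f := ⟨fun ω => f.fn (reversal ω), D.comp_reversal_mem f.2⟩
  map_add' _ _ := rfl
  map_smul' _ _ := rfl

theorem finite_support_noise {f : Config → ℝ} (hf : IsLocal f) (ω : Config) :
    (Function.support fun x => f (flipAt x ω) - f ω).Finite := by
  obtain ⟨Λ, hΛ⟩ := hf
  refine Λ.finite_toSet.subset fun x hx => ?_
  by_contra hcon
  exact hx (sub_eq_zero.2 (comp_flipAt_eq hΛ hcon ω))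

/-- The noise operator, acting on local functions. -/
def noiseLin : LocalFn D.site →ₗ[ℝ] LocalFn D.site where
  toFun f := ⟨noise f.fn, D.noise_mem f.2⟩
  map_add' f g := LocalFn.ext fun ω => by
    change noise (fun ω => f.fn ω + g.fn ω) ω = noise f.fn ω + noise g.fn ω
    unfold noise
    rw [← finsum_add_distrib (finite_support_noise (f := f.fn) f.2.1 ω)
      (finite_support_noise (f := g.fn) g.2.1 ω)]
    exact finsum_congr fun x => by ring
  map_smul' c f := LocalFn.ext fun ω => by
    change noise (fun ω => c * f.fn ω) ω = c * noise f.fn ω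
    unfold noise
    rw [← smul_eq_mul c, smul_finsum]
    exact finsum_congr fun x => by rw [smul_eq_mul]; ring

theorem flipLin_fn (x : ℤ) (f : LocalFn D.site) (ω : Config) :
    (D.flipLin x f).fn ω = f.fn (flipAt x ω) := rfl

theorem reversalLin_fn (f : LocalFn D.site) (ω : Config) :
    (D.reversalLin f).fn ω = f.fn (reversal ω) := rfl

theorem noiseLin_fn (f : LocalFn D.site) (ω : Config) :
    (D.noiseLin f).fn ω = noise f.fn ω := rfl

theorem inner_noiseLin (f g : LocalFn D.site) :
    inner ℝ f (D.noiseLin g) = inner ℝ (D.noiseLin f) g := D.fluct_noise f.2 g.2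

theorem flipLin_flipLin (x : ℤ) (f : LocalFn D.site) : D.flipLin x (D.flipLin x f) = f :=
  LocalFn.ext fun ω => by rw [flipLin_fn, flipLin_fn, flipAt_flipAt]

theorem flipLin_comm (x y : ℤ) (f : LocalFn D.site) :
    D.flipLin x (D.flipLin y f) = D.flipLin y (D.flipLin x f) :=
  LocalFn.ext fun ω => by simp only [flipLin_fn, flipAt_comm]

/-- The joint eigenspaces of the noise operator and of the reversal of all momenta: sums of
functions that are odd in `k` momenta and even in all others. -/
def chaos (k : ℕ) : Submodule ℝ (LocalFn D.site) where
  carrier := {g | D.noiseLin g = (-(2 * k) : ℝ) • g ∧ D.reversalLin g = ((-1) ^ k : ℝ) • g}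
  zero_mem' := by simp
  add_mem' := by
    rintro f g ⟨hf1, hf2⟩ ⟨hg1, hg2⟩
    exact ⟨by rw [map_add, hf1, hg1, smul_add], by rw [map_add, hf2, hg2, smul_add]⟩
  smul_mem' := by
    rintro c f ⟨hf1, hf2⟩
    exact ⟨by rw [map_smul, hf1, smul_comm], by rw [map_smul, hf2, smul_comm]⟩

/-- Simultaneous diagonalization of commuting involutions, one site at a time: `g` is half the sum
of its even part `g + flip g` and its odd part `g - flip g`. -/
theorem mem_span_flip_eigen (Λ A : Finset ℤ) {f : LocalFn D.site}
    (hf : DependsOn f.fn (Λ : Set ℤ)) :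
    f ∈ Submodule.span ℝ {g : LocalFn D.site | DependsOn g.fn (Λ : Set ℤ) ∧
      ∀ x ∈ A, D.flipLin x g = g ∨ D.flipLin x g = -g} := by
  induction A using Finset.induction_on with
  | empty => exact Submodule.subset_span ⟨hf, by simp⟩
  | insert a A ha ih =>
    refine Submodule.span_le.2 ?_ ih
    rintro g ⟨hg, hA⟩
    have hdep (ε : ℝ) : DependsOn (g + ε • D.flipLin a g).fn (Λ : Set ℤ) := fun p q h => by
      simp only [LocalFn.fn_add, LocalFn.fn_smul, flipLin_fn, hg h, hg.comp_flipAt a h]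
    have hx (ε : ℝ) (x : ℤ) (hx : x ∈ A) :
        D.flipLin x (g + ε • D.flipLin a g) = g + ε • D.flipLin a g ∨
          D.flipLin x (g + ε • D.flipLin a g) = -(g + ε • D.flipLin a g) := by
      rw [map_add, map_smul, flipLin_comm]
      rcases hA x hx with h | h
      · left; rw [h]
      · right; rw [h, map_neg]; module
    have h1 : g + (1 : ℝ) • D.flipLin a g ∈ Submodule.span ℝ {g : LocalFn D.site |
        DependsOn g.fn (Λ : Set ℤ) ∧
          ∀ x ∈ insert a A, D.flipLin x g = g ∨ D.flipLin x g = -g} := by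
      refine Submodule.subset_span ⟨hdep 1, fun x hxA => ?_⟩
      rcases Finset.mem_insert.1 hxA with rfl | hxA
      · left
        rw [map_add, map_smul, flipLin_flipLin]
        module
      · exact hx 1 x hxA
    have h2 : g + (-1 : ℝ) • D.flipLin a g ∈ Submodule.span ℝ {g : LocalFn D.site |
        DependsOn g.fn (Λ : Set ℤ) ∧
          ∀ x ∈ insert a A, D.flipLin x g = g ∨ D.flipLin x g = -g} := by
      refine Submodule.subset_span ⟨hdep (-1), fun x hxA => ?_⟩
      rcases Finset.mem_insert.1 hxA with rfl | hxA
      · right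
        rw [map_add, map_smul, flipLin_flipLin]
        module
      · exact hx (-1) x hxA
    have e : g = (1 / 2 : ℝ) • (g + (1 : ℝ) • D.flipLin a g)
        + (1 / 2 : ℝ) • (g + (-1 : ℝ) • D.flipLin a g) := by module
    rw [e]
    exact add_mem (Submodule.smul_mem _ _ h1) (Submodule.smul_mem _ _ h2)

theorem mem_chaos_of_flip_eigen (Λ : Finset ℤ) {g : LocalFn D.site}
    (hg : DependsOn g.fn (Λ : Set ℤ)) (hΛ : ∀ x ∈ Λ, D.flipLin x g = g ∨ D.flipLin x g = -g) :
    ∃ k, g ∈ D.chaos k := by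
  classical
  set ε : ℤ → ℕ := fun x => if D.flipLin x g = g then 0 else 1 with hε
  have hflip (x : ℤ) (hx : x ∈ Λ) (ω : Config) :
      g.fn (flipAt x ω) = (-1) ^ ε x * g.fn ω := by
    rw [← flipLin_fn]
    by_cases h : D.flipLin x g = g
    · simp [hε, h]
    · have h' := (hΛ x hx).resolve_left h
      simp only [hε, h, if_false, pow_one]
      rw [h', LocalFn.fn_neg]
      ring
  refine ⟨∑ x ∈ Λ, ε x, LocalFn.ext fun ω => ?_, LocalFn.ext fun ω => ?_⟩
  · rw [noiseLin_fn, noise_eq_sum hg, LocalFn.fn_smul]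
    push_cast
    rw [Finset.mul_sum, ← Finset.sum_neg_distrib, Finset.sum_mul]
    refine Finset.sum_congr rfl fun x hx => ?_
    rw [hflip x hx]
    by_cases h : D.flipLin x g = g
    · simp [hε, h]
    · simp only [hε, h, if_false]
      push_cast
      ring
  · rw [reversalLin_fn, LocalFn.fn_smul]
    -- Reversing the momenta in `A` multiplies `g` by the product of its signs; for `A = Λ` this
    -- agrees with the full reversal on all sites that `g` sees.
    have key : ∀ A : Finset ℤ, A ⊆ Λ →
        g.fn (fun i => if i ∈ A then ((ω i).1, -(ω i).2) else ω i)
          = (-1) ^ (∑ x ∈ A, ε x) * g.fn ω := by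
      intro A
      induction A using Finset.induction_on with
      | empty => simp
      | insert a A ha ih =>
        intro hA
        rw [Finset.sum_insert ha, pow_add, mul_assoc,
          ← ih ((Finset.subset_insert a A).trans hA), ← hflip a (hA (Finset.mem_insert_self a A))]
        congr 1
        rw [flipAt_eq_ite]
        funext i
        by_cases hi : i = a
        · subst hi; simp [ha]
        · simp [hi]
    rw [← key Λ subset_rfl]
    exact hg fun i hi => by simp [reversal, Finset.mem_coe.1 hi]

theorem mem_iSup_chaos (f : LocalFn D.site) : f ∈ ⨆ k, D.chaos k := by
  obtain ⟨Λ, hΛ⟩ := f.2.1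
  refine Submodule.span_le.2 ?_ (D.mem_span_flip_eigen Λ Λ hΛ)
  rintro g ⟨hg, hgΛ⟩
  obtain ⟨k, hk⟩ := D.mem_chaos_of_flip_eigen Λ hg hgΛ
  exact Submodule.mem_iSup_of_mem k hk

/-- The noise operator has a gap on the functions that are odd under momentum reversal. -/
theorem noise_gap (f : LocalFn D.site) :
    1 / 2 * inner ℝ (f - D.reversalLin f) (f - D.reversalLin f) ≤ -inner ℝ f (D.noiseLin f) := by
  obtain ⟨c, hc, hsum⟩ := (Submodule.mem_iSup_iff_exists_finsupp _ _).1 (D.mem_iSup_chaos f)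
  -- The noise is symmetric with distinct eigenvalues `-2k` and `-2l`.
  have horth (k l : ℕ) (hkl : k ≠ l) : inner ℝ (c k) (c l) = 0 := by
    have h := D.inner_noiseLin (c k) (c l)
    rw [(hc k).1, (hc l).1, inner_smul_left, inner_smul_right, conj_trivial] at h
    have h1 : ((k : ℝ) - l) * inner ℝ (c k) (c l) = 0 := by linarith
    exact (mul_eq_zero.1 h1).resolve_left (sub_ne_zero.2 (Nat.cast_injective.ne hkl))
  have hexp (a b : ℕ → ℝ) : inner ℝ (∑ k ∈ c.support, a k • c k) (∑ k ∈ c.support, b k • c k)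
      = ∑ k ∈ c.support, a k * b k * inner ℝ (c k) (c k) := by
    rw [sum_inner]
    refine Finset.sum_congr rfl fun k hk => ?_
    rw [inner_sum, Finset.sum_eq_single k]
    · rw [inner_smul_left, inner_smul_right, conj_trivial]; ring
    · intro l _ hl
      rw [inner_smul_left, inner_smul_right, horth k l hl.symm]; ring
    · exact fun h => absurd hk h
  have e0 : f = ∑ k ∈ c.support, (1 : ℝ) • c k := by
    simp only [one_smul]; exact hsum.symm
  have e1 : D.noiseLin f = ∑ k ∈ c.support, (-(2 * k) : ℝ) • c k := by
    conv_lhs => rw [e0]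
    simp only [one_smul, map_sum]
    exact Finset.sum_congr rfl fun k _ => (hc k).1
  have e2 : f - D.reversalLin f = ∑ k ∈ c.support, (1 - (-1) ^ k : ℝ) • c k := by
    conv_lhs => rw [e0]
    simp only [one_smul, map_sum]
    rw [← Finset.sum_sub_distrib]
    refine Finset.sum_congr rfl fun k _ => ?_
    rw [(hc k).2, sub_smul, one_smul]
  rw [e2, e1, hexp]
  conv_rhs => rw [e0]
  rw [hexp, Finset.mul_sum, ← Finset.sum_neg_distrib]
  refine Finset.sum_le_sum fun k _ => ?_
  have hn : 0 ≤ inner ℝ (c k) (c k) := real_inner_self_nonneg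
  rw [← mul_assoc, ← neg_mul]
  refine mul_le_mul_of_nonneg_right ?_ hn
  -- The inequality has become `(1 - (-1)^k)²/2 ≤ 2k`: trivial for even `k`, and `2 ≤ 2k` for odd
  -- `k`, with equality at `k = 1`.
  rcases Nat.even_or_odd k with h | h
  · rw [h.neg_one_pow]; simp
  · rw [h.neg_one_pow]
    have : (1 : ℝ) ≤ k := by exact_mod_cast h.pos
    linarith

theorem inner_reversalLin_reversalLin (f g : LocalFn D.site) :
    inner ℝ (D.reversalLin f) (D.reversalLin g) = inner ℝ f g := by
  change fluct D.site (fun ω => f.fn (reversal ω)) (fun ω => g.fn (reversal ω)) = _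
  rw [LocalFn.inner_eq_fluct]
  unfold fluct
  refine finsum_congr fun x => ?_
  rw [D.integral_comp_reversal, D.integral_comp_reversal]
  simp only [← shift_reversal]
  rw [D.integral_comp_reversal fun ω => f.fn ω * g.fn (shift x ω)]

theorem reversalLin_reversalLin (f : LocalFn D.site) : D.reversalLin (D.reversalLin f) = f :=
  LocalFn.ext fun ω => by rw [reversalLin_fn, reversalLin_fn, reversal_reversal]

theorem inner_reversalLin_left (f g : LocalFn D.site) :
    inner ℝ (D.reversalLin f) g = inner ℝ f (D.reversalLin g) := by
  rw [← D.inner_reversalLin_reversalLin, reversalLin_reversalLin]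

theorem norm_reversalLin (f : LocalFn D.site) : ‖D.reversalLin f‖ = ‖f‖ := by
  rw [@norm_eq_sqrt_real_inner, @norm_eq_sqrt_real_inner, inner_reversalLin_reversalLin]

/-- The reversal of all momenta, acting on `𝓗`. -/
def reversalHilbert : D.hilbert →L[ℝ] D.hilbert :=
  (D.reversalLin.mkContinuous 1 fun f => by rw [norm_reversalLin, one_mul]).completion

theorem reversalHilbert_coe (f : LocalFn D.site) :
    D.reversalHilbert (f : D.hilbert) = ((D.reversalLin f : LocalFn D.site) : D.hilbert) :=
  ContinuousLinearMap.completion_apply_coe _ _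

theorem inner_reversalHilbert_left (u v : D.hilbert) :
    inner ℝ (D.reversalHilbert u) v = inner ℝ u (D.reversalHilbert v) := by
  induction u, v using UniformSpace.Completion.induction_on₂ with
  | hp => exact isClosed_eq (by fun_prop) (by fun_prop)
  | ih f g =>
    rw [reversalHilbert_coe, reversalHilbert_coe, UniformSpace.Completion.inner_coe,
      UniformSpace.Completion.inner_coe, inner_reversalLin_left]

end OscillatorChain

/-! ### Examples of smooth observables -/

namespace OscillatorChain

variable {D : OscillatorChain}

namespace IsSmoothObservable

theorem add {f g : Config → ℝ} (hf : D.IsSmoothObservable f) (hg : D.IsSmoothObservable g) :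
    D.IsSmoothObservable fun ω => f ω + g ω where
  isLocal := by
    obtain ⟨A, hA⟩ := hf.isLocal
    obtain ⟨B, hB⟩ := hg.isLocal
    exact ⟨A ∪ B, fun a b h => congr_arg₂ (· + ·) (hA fun i hi => h i (by
      simp [Finset.mem_coe.1 hi])) (hB fun i hi => h i (by simp [Finset.mem_coe.1 hi]))⟩
  differentiableR x ω := (hf.differentiableR x ω).add (hg.differentiableR x ω)
  differentiableP x ω := (hf.differentiableP x ω).add (hg.differentiableP x ω)
  memLp q hq := (hf.memLp q hq).add (hg.memLp q hq)
  memLpR x q hq := ((hf.memLpR x q hq).add (hg.memLpR x q hq)).ae_eq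
    (Eventually.of_forall fun ω =>
      (deriv_fun_add (hf.differentiableR x ω _) (hg.differentiableR x ω _)).symm)
  memLpP x q hq := ((hf.memLpP x q hq).add (hg.memLpP x q hq)).ae_eq
    (Eventually.of_forall fun ω =>
      (deriv_fun_add (hf.differentiableP x ω _) (hg.differentiableP x ω _)).symm)

theorem const (c : ℝ) : D.IsSmoothObservable fun _ => c where
  isLocal := ⟨∅, fun _ _ _ => rfl⟩
  differentiableR _ _ := differentiable_const _
  differentiableP _ _ := differentiable_const _
  memLp _ _ := memLp_const _
  memLpR x q _ := by
    have : partialR x (fun _ => c) = fun _ => 0 := by funext ω; simp [partialR]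
    rw [this]; exact memLp_const _
  memLpP x q _ := by
    have : partialP x (fun _ => c) = fun _ => 0 := by funext ω; simp [partialP]
    rw [this]; exact memLp_const _

theorem momentum (x : ℤ) : D.IsSmoothObservable fun ω => (ω x).2 where
  isLocal := ⟨{x}, fun a b h => congr_arg Prod.snd (h x (by simp))⟩
  differentiableR y ω := by
    by_cases h : x = y
    · subst h; simp
    · simp [h]
  differentiableP y ω := by
    by_cases h : x = y
    · subst h; simp
    · simp [h]
  memLp q hq := D.memLp_momentum_at x hq
  memLpR y q _ := by
    have : partialR y (fun ω => (ω x).2) = fun _ => 0 := by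
      funext ω
      by_cases h : x = y
      · subst h; simp [partialR]
      · simp [partialR, h]
    rw [this]; exact memLp_const _
  memLpP y q _ := by
    have : partialP y (fun ω => (ω x).2) = fun _ => if x = y then 1 else 0 := by
      funext ω
      by_cases h : x = y
      · subst h; simp [partialP]
      · simp [partialP, h]
    rw [this]; exact memLp_const _

theorem of_contDiff {Λ : Finset ℤ} {F : (Λ → ℝ × ℝ) → ℝ} (hF : ContDiff ℝ 1 F)
    (hc : HasCompactSupport F) : D.IsSmoothObservable fun ω => F fun x => ω x := by
  have hres : Measurable fun (ω : Config) (x : Λ) => ω x :=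
    measurable_pi_iff.2 fun x => measurable_pi_apply _
  have hbdd {G : (Λ → ℝ × ℝ) → ℝ} (hG : Continuous G) (hGc : HasCompactSupport G)
      (q : ENNReal) : MemLp (fun ω : Config => G fun x => ω x) q D.gibbs := by
    obtain ⟨C, hC⟩ := hGc.exists_bound_of_continuous hG
    exact MemLp.of_bound (hG.measurable.comp hres).aestronglyMeasurable C
      (Eventually.of_forall fun ω => hC _)
  have hderiv (x : ℤ) (ω : Config) {c : ℝ → ℝ × ℝ} {v : ℝ × ℝ} {s : ℝ} (h : HasDerivAt c v s) :
      HasDerivAt (fun s => F fun y : Λ => Function.update ω x (c s) y)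
        (fderiv ℝ F (fun y : Λ => Function.update ω x (c s) y)
          fun y : Λ => if (y : ℤ) = x then v else 0) s := by
    have h1 : HasDerivAt (fun (s : ℝ) (y : Λ) => Function.update ω x (c s) y)
        (fun y : Λ => if (y : ℤ) = x then v else 0) s := by
      refine hasDerivAt_pi.2 fun y => ?_
      by_cases hy : (y : ℤ) = x
      · simpa [hy] using h
      · simpa [hy] using hasDerivAt_const s (ω y)
    exact ((hF.differentiable one_ne_zero _).hasFDerivAt).comp_hasDerivAt s h1
  have hcr (ω : Config) (x : ℤ) (s : ℝ) : HasDerivAt (fun s => (s, (ω x).2)) ((1, 0) : ℝ × ℝ) s :=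
    (hasDerivAt_id s).prodMk (hasDerivAt_const s _)
  have hcp (ω : Config) (x : ℤ) (s : ℝ) : HasDerivAt (fun s => ((ω x).1, s)) ((0, 1) : ℝ × ℝ) s :=
    (hasDerivAt_const s _).prodMk (hasDerivAt_id s)
  have hfd (w : Λ → ℝ × ℝ) (q : ENNReal) :
      MemLp (fun ω : Config => fderiv ℝ F (fun x => ω x) w) q D.gibbs := by
    refine hbdd (G := fun z => fderiv ℝ F z w) ?_ ?_ q
    · exact (hF.continuous_fderiv one_ne_zero).clm_apply continuous_const
    · exact hc.fderiv_apply ℝ w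
  refine ⟨⟨Λ, fun a b h => ?_⟩, fun x ω s => (hderiv x ω (hcr ω x s)).differentiableAt,
    fun x ω s => (hderiv x ω (hcp ω x s)).differentiableAt, fun q _ => hbdd hF.continuous hc q,
    fun x q _ => ?_, fun x q _ => ?_⟩
  · exact congr_arg F (funext fun y : Λ => h y (Finset.mem_coe.2 y.2))
  · have : partialR x (fun ω : Config => F fun y : Λ => ω y) = fun ω =>
        fderiv ℝ F (fun y => ω y) fun y : Λ => if (y : ℤ) = x then (1, 0) else 0 := by
      funext ω
      unfold partialR
      rw [(hderiv x ω (hcr ω x _)).deriv]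
      simp
    rw [this]
    exact hfd _ q
  · have : partialP x (fun ω : Config => F fun y : Λ => ω y) = fun ω =>
        fderiv ℝ F (fun y => ω y) fun y : Λ => if (y : ℤ) = x then (0, 1) else 0 := by
      funext ω
      unfold partialP
      rw [(hderiv x ω (hcp ω x _)).deriv]
      simp
    rw [this]
    exact hfd _ q

theorem of_mem_testFunctions {f : Config → ℝ} (hf : f ∈ testFunctions) :
    D.IsSmoothObservable f := by
  induction hf using Submodule.span_induction with
  | mem f h =>
    obtain ⟨Λ, F, hF, hc, rfl⟩ := h
    exact of_contDiff hF hc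
  | zero => exact const 0
  | add f g _ _ hf hg => exact hf.add hg
  | smul c f _ hf => exact (const c).mul hf

end IsSmoothObservable

variable (D)

/-! ### The symmetrized current -/

/-- The kinetic energy `p_0² / 2`. -/
def kineticFn (ω : Config) : ℝ := 1 / 2 * ((ω 0).2 * (ω 0).2)

/-- `p_0 (V'(r_1) - V'(r_0))`, the time derivative of the kinetic energy. -/
def powerFn (ω : Config) : ℝ := (ω 0).2 * (deriv D.V (ω 1).1 - deriv D.V (ω 0).1)

theorem isSmoothObservable_kineticFn : D.IsSmoothObservable kineticFn :=
  (IsSmoothObservable.const _).mul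
    ((IsSmoothObservable.momentum 0).mul (IsSmoothObservable.momentum 0))

theorem dependsOn_kineticFn : DependsOn kineticFn (({0} : Finset ℤ) : Set ℤ) :=
  fun a b h => by simp [kineticFn, h 0 (by simp)]

theorem liouville_kineticFn (ω : Config) : D.liouville kineticFn ω = D.powerFn ω := by
  rw [D.liouville_eq_sum dependsOn_kineticFn, Finset.sum_singleton]
  have h1 : partialR 0 kineticFn ω = 0 := by simp [partialR, kineticFn]
  have h2 : partialP 0 kineticFn ω = (ω 0).2 := by
    have : HasDerivAt (fun s : ℝ => 1 / 2 * (s * s)) (ω 0).2 (ω 0).2 := by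
      convert! ((hasDerivAt_id (ω 0).2).mul (hasDerivAt_id (ω 0).2)).const_mul (1 / 2 : ℝ) using 1
      simp
      ring
    simpa [partialP, kineticFn] using this.deriv
  rw [h1, h2, powerFn]
  simp
  ring

theorem noise_kineticFn (ω : Config) : noise kineticFn ω = 0 := by
  rw [noise_eq_sum dependsOn_kineticFn, Finset.sum_singleton, kineticFn, flipAt_snd_self, kineticFn]
  ring

theorem kineticFn_mem : kineticFn ∈ localSubmodule D.site := by
  have hp : Measurable fun ω : Config => (ω 0).2 := measurable_snd.comp (measurable_pi_apply 0)
  exact ⟨D.isSmoothObservable_kineticFn.isLocal, (hp.mul hp).const_mul _,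
    D.isSmoothObservable_kineticFn.memLp 2 ENNReal.ofNat_ne_top⟩

theorem momentum_mul_force_mem :
    (fun ω : Config => (ω 0).2 * deriv D.V (ω 0).1) ∈ localSubmodule D.site := by
  have hm : Measurable fun z : ℝ × ℝ => z.2 * deriv D.V z.1 :=
    measurable_snd.mul (D.measurable_force.comp measurable_fst)
  have hV : MemLp (deriv D.V) 2 (volume.tilted fun r => -D.V r / D.T) := by
    rw [memLp_two_iff_integrable_sq D.measurable_force.aestronglyMeasurable,
      integrable_tilted_iff D.integrable_gibbs]
    simpa [mul_comm] using D.integrable_force_sq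
  have hp : MemLp (id : ℝ → ℝ) 2 (gaussianReal 0 D.T.toNNReal) := memLp_id_gaussianReal 2
  have h1 : MemLp (fun z : ℝ × ℝ => z.2 * deriv D.V z.1) 2 D.site := by
    rw [memLp_two_iff_integrable_sq hm.aestronglyMeasurable]
    refine (hV.integrable_sq.mul_prod hp.integrable_sq).congr (Eventually.of_forall fun z => ?_)
    simp only [id]
    ring
  exact ⟨⟨{0}, fun a b h => by simp [h 0 (by simp)]⟩, hm.comp (measurable_pi_apply 0),
    h1.comp_measurePreserving (measurePreserving_eval_infinitePi (fun _ : ℤ => D.site) 0)⟩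

theorem powerFn_mem : D.powerFn ∈ localSubmodule D.site := by
  have h := neg_mem (add_mem D.currentFn_mem D.momentum_mul_force_mem)
  have e : D.powerFn = -(D.currentFn + fun ω : Config => (ω 0).2 * deriv D.V (ω 0).1) := by
    funext ω
    simp only [powerFn, currentFn, Pi.neg_apply, Pi.add_apply]
    ring
  rw [e]
  exact h

/-- The kinetic energy as a square integrable local function. -/
def kineticLocal : LocalFn D.site := ⟨kineticFn, D.kineticFn_mem⟩

/-- The time derivative of the kinetic energy as a square integrable local function. -/
def powerLocal : LocalFn D.site := ⟨D.powerFn, D.powerFn_mem⟩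

/-- The current symmetrized by a multiple of the time derivative of the kinetic energy. -/
def symmCurrent : LocalFn D.site := D.currentLocal + (1 / 2 : ℝ) • D.powerLocal

theorem symmCurrent_fn (ω : Config) : D.symmCurrent.fn ω
    = -(1 / 2) * ((ω 0).2 * (deriv D.V (ω 1).1 + deriv D.V (ω 0).1)) := by
  rw [symmCurrent, LocalFn.fn_add, LocalFn.fn_smul]
  change D.currentFn ω + 1 / 2 * D.powerFn ω = _
  simp only [currentFn, powerFn]
  ring

/-- Integration by parts against the constant `1`: this is where zero pressure enters. -/
theorem integral_force : ∫ ω, deriv D.V (ω 0).1 ∂D.gibbs = 0 := by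
  have h := D.integral_partialR 0 (h := fun _ => 1) (fun _ => differentiable_const _)
    (integrable_const _) ((integrable_const 0).congr (Eventually.of_forall fun ω => by
      simp [partialR]))
    (by simpa using (D.memLp_force_at 0).integrable one_le_two)
  simp only [partialR, deriv_const, integral_zero, mul_one] at h
  have hT := D.T_pos.ne'
  field_simp at h
  simpa using h.symm

theorem integral_force_mul_force :
    ∫ ω, deriv D.V (ω 1).1 * deriv D.V (ω 0).1 ∂D.gibbs = 0 := by
  have e : partialR 1 (fun ω => deriv D.V (ω 0).1) = fun _ => 0 := by
    funext ω; simp [partialR]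
  have h := D.integral_partialR 1 (h := fun ω => deriv D.V (ω 0).1) (fun ω => by simp)
    ((D.memLp_force_at 0).integrable one_le_two) (by rw [e]; exact integrable_const _)
    ((D.memLp_force_at 1).integrable_mul (D.memLp_force_at 0))
  rw [e, integral_zero] at h
  have hT := D.T_pos.ne'
  field_simp at h
  simpa using h.symm

theorem integral_force_add_sq :
    ∫ ω, (deriv D.V (ω 1).1 + deriv D.V (ω 0).1) ^ 2 ∂D.gibbs
      = 2 * Var[fun ω => deriv D.V (ω 0).1; D.gibbs] := by
  have i0 := (D.memLp_force_at 0).integrable_sq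
  have i1 := (D.memLp_force_at 1).integrable_sq
  have i2 : Integrable (fun ω => deriv D.V (ω 1).1 * deriv D.V (ω 0).1) D.gibbs :=
    (D.memLp_force_at 1).integrable_mul (D.memLp_force_at 0)
  have hm : Measurable fun ω : Config => deriv D.V (ω 0).1 :=
    D.measurable_force.comp (measurable_fst.comp (measurable_pi_apply 0))
  have e1 : ∫ ω, deriv D.V (ω 1).1 ^ 2 ∂D.gibbs = ∫ ω, deriv D.V (ω 0).1 ^ 2 ∂D.gibbs :=
    integral_shift (ν := D.site) (hm.pow_const 2) 1
  rw [variance_of_integral_eq_zero hm.aemeasurable D.integral_force]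
  have e (ω : Config) : (deriv D.V (ω 1).1 + deriv D.V (ω 0).1) ^ 2
      = deriv D.V (ω 1).1 ^ 2 + (2 * (deriv D.V (ω 1).1 * deriv D.V (ω 0).1)
        + deriv D.V (ω 0).1 ^ 2) := by ring
  have i3 : Integrable (fun ω => 2 * (deriv D.V (ω 1).1 * deriv D.V (ω 0).1)
      + deriv D.V (ω 0).1 ^ 2) D.gibbs := (i2.const_mul 2).add i0
  simp only [e]
  rw [integral_add i1 i3, integral_add (i2.const_mul 2) i0,
    integral_const_mul, D.integral_force_mul_force, e1]
  ring

/-- For `x ≠ 0` the product with the shift by `x` is odd in `p_0`, so only `x = 0` contributes;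
there `p_0` is integrated out and contributes its variance `T`. -/
theorem inner_symmCurrent_self : inner ℝ D.symmCurrent D.symmCurrent
    = D.T * Var[fun ω => deriv D.V (ω 0).1; D.gibbs] / 2 := by
  set W : Config → ℝ := fun ω => deriv D.V (ω 1).1 + deriv D.V (ω 0).1 with hW
  have hfn (ω : Config) : D.symmCurrent.fn ω = -(1 / 2) * ((ω 0).2 * W ω) := D.symmCurrent_fn ω
  have hWflip (x : ℤ) (ω : Config) : W (flipAt x ω) = W ω := by
    simp only [hW, flipAt_fst]
  have hflip (ω : Config) : D.symmCurrent.fn (flipAt 0 ω) = -D.symmCurrent.fn ω := by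
    rw [hfn, hfn, hWflip, flipAt_snd_self]
    ring
  rw [LocalFn.inner_eq_fluct]
  unfold fluct
  rw [D.integral_eq_zero_of_flipAt hflip]
  simp only [zero_mul, sub_zero]
  rw [finsum_eq_single _ (0 : ℤ)]
  · have hWm : MemLp W 2 D.gibbs := (D.memLp_force_at 1).add (D.memLp_force_at 0)
    have hpW : MemLp (fun ω => (ω 0).2 * W ω) 2 D.gibbs := by
      refine (D.symmCurrent.2.2.2.const_mul (-2)).ae_eq (Eventually.of_forall fun ω => ?_)
      change -2 * D.symmCurrent.fn ω = _
      rw [hfn]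
      ring
    have hWupd (ω : Config) (s : ℝ) : W (Function.update ω 0 ((ω 0).1, s)) = W ω := by
      simp [hW]
    have hpart : partialP 0 (fun ω => (ω 0).2 * W ω ^ 2) = fun ω => W ω ^ 2 := by
      funext ω
      simp [partialP, hWupd]
    -- Gaussian integration by parts with `h = p_0 W²` gives `∫ p_0² W² = T ∫ W²`.
    have h := D.integral_partialP 0 (h := fun ω => (ω 0).2 * W ω ^ 2)
      (fun ω => by simp [hWupd])
      ((hpW.integrable_mul hWm).congr (Eventually.of_forall fun ω => by
        simp only [Pi.mul_apply]; ring))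
      (by rw [hpart]; exact hWm.integrable_sq)
      (hpW.integrable_sq.congr (Eventually.of_forall fun ω => by ring))
    rw [hpart, eq_div_iff D.T_pos.ne'] at h
    have e0 (ω : Config) : shift 0 ω = ω := by funext i; simp [shift]
    have e (ω : Config) : D.symmCurrent.fn ω * D.symmCurrent.fn (shift 0 ω)
        = 1 / 4 * ((ω 0).2 * ((ω 0).2 * W ω ^ 2)) := by
      rw [e0, hfn]; ring
    simp only [e]
    rw [integral_const_mul, ← h, D.integral_force_add_sq]
    ring
  · intro x hx
    refine D.integral_eq_zero_of_flipAt (x := 0) fun ω => ?_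
    have : D.symmCurrent.fn (shift x (flipAt 0 ω)) = D.symmCurrent.fn (shift x ω) := by
      rw [shift_flipAt, hfn, hfn, hWflip, flipAt_of_ne (by omega)]
    rw [hflip, this]
    ring

/-! ### The generator on test functions -/

theorem inner_liouville {f g a b : LocalFn D.site} (hf : D.IsSmoothObservable f.fn)
    (hg : D.IsSmoothObservable g.fn) (ha : ∀ ω, a.fn ω = D.liouville f.fn ω)
    (hb : ∀ ω, b.fn ω = D.liouville g.fn ω) : inner ℝ f b = -inner ℝ a g := by
  rw [LocalFn.inner_eq_fluct, LocalFn.inner_eq_fluct, funext ha, funext hb]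
  exact hf.fluct_liouville hg

theorem fn_sub_noiseLin {f g : LocalFn D.site} (hg : g.fn = D.formalGen f.fn) (ω : Config) :
    (g - D.γ • D.noiseLin f).fn ω = D.liouville f.fn ω := by
  rw [LocalFn.fn_sub, LocalFn.fn_smul, noiseLin_fn, hg, formalGen]
  ring

theorem reversalLin_noiseLin (f : LocalFn D.site) :
    D.reversalLin (D.noiseLin f) = D.noiseLin (D.reversalLin f) :=
  LocalFn.ext fun ω => (noise_comp_reversal f.fn ω).symm

section TestFunctions

variable {D} {f g : LocalFn D.site}

/-- The Liouville part drops out of `⟨f, L f⟩` by antisymmetry, and the noise gap controls the rest.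
-/
theorem dissipation_le (hf : f.fn ∈ testFunctions) (hg : g.fn = D.formalGen f.fn) :
    D.γ / 2 * ‖f - D.reversalLin f‖ ^ 2 ≤ -inner ℝ f g := by
  have hs : D.IsSmoothObservable f.fn := .of_mem_testFunctions hf
  have h1 := D.inner_liouville hs hs (D.fn_sub_noiseLin hg) (D.fn_sub_noiseLin hg)
  rw [real_inner_comm f, inner_sub_right, inner_smul_right] at h1
  have h2 := mul_le_mul_of_nonneg_left (D.noise_gap f) D.γ_pos.le
  rw [real_inner_self_eq_norm_sq] at h2
  linarith

theorem inner_reversalLin_gen (hf : f.fn ∈ testFunctions) (hg : g.fn = D.formalGen f.fn)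
    {f' g' : LocalFn D.site} (hf' : f'.fn ∈ testFunctions)
    (hg' : g'.fn = D.formalGen f'.fn) :
    inner ℝ (D.reversalLin g) f' = inner ℝ (D.reversalLin f) g' := by
  have hs : D.IsSmoothObservable f.fn := .of_mem_testFunctions hf
  -- The Liouville operator anticommutes with the reversal, which cancels the sign from its
  -- antisymmetry.
  have h1 := D.inner_liouville (f := D.reversalLin f)
    (a := -D.reversalLin (g - D.γ • D.noiseLin f)) hs.comp_reversal (.of_mem_testFunctions hf')
    (fun ω => by
      rw [LocalFn.fn_neg, reversalLin_fn, D.fn_sub_noiseLin hg, ← neg_eq_iff_eq_neg.2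
        (D.liouville_comp_reversal f.fn ω)]
      simp only [neg_neg]
      rfl)
    (D.fn_sub_noiseLin hg')
  rw [map_sub, map_smul, reversalLin_noiseLin, inner_neg_left, inner_sub_left, inner_sub_right,
    inner_smul_left, inner_smul_right, ← D.inner_noiseLin, conj_trivial] at h1
  linarith

/-- A weak form of `L φ = ψ`, up to the sign from antisymmetry. The kinetic energy is not compactly
supported, so the identity is tested against `C_0^1(Ω)` and nothing is claimed about its membership
in the domain. -/
theorem inner_powerLocal (hf : f.fn ∈ testFunctions) (hg : g.fn = D.formalGen f.fn) :
    inner ℝ D.powerLocal f = -inner ℝ D.kineticLocal g := by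
  have h1 := D.inner_liouville (f := D.kineticLocal) (a := D.powerLocal)
    D.isSmoothObservable_kineticFn (.of_mem_testFunctions hf)
    (fun ω => (D.liouville_kineticFn ω).symm) (D.fn_sub_noiseLin hg)
  have h2 : D.noiseLin D.kineticLocal = 0 := LocalFn.ext fun ω => noise_kineticFn ω
  rw [inner_sub_right, inner_smul_right, D.inner_noiseLin, h2, inner_zero_left] at h1
  linarith

end TestFunctions

/-! ### Extension from the core to the closed generator -/

theorem closure_preGraph_subset {s : Set (D.hilbert × D.hilbert)} (hs : IsClosed s)
    (h : ∀ f g : LocalFn D.site, f.fn ∈ testFunctions → g.fn = D.formalGen f.fn →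
      ((f : D.hilbert), (g : D.hilbert)) ∈ s) : closure D.preGraph ⊆ s := by
  refine closure_minimal ?_ hs
  rintro _ ⟨f, g, hf, hg, rfl⟩
  exact h f g hf hg

theorem dissipation_le_of_mem {q : D.hilbert × D.hilbert} (hq : q ∈ closure D.preGraph) :
    D.γ / 2 * ‖q.1 - D.reversalHilbert q.1‖ ^ 2 ≤ -inner ℝ q.1 q.2 := by
  refine D.closure_preGraph_subset (s := {q | D.γ / 2 * ‖q.1 - D.reversalHilbert q.1‖ ^ 2
    ≤ -inner ℝ q.1 q.2}) (isClosed_le (by fun_prop) (by fun_prop)) (fun f g hf hg => ?_) hq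
  rw [Set.mem_ofPred_eq, reversalHilbert_coe, ← UniformSpace.Completion.coe_sub,
    UniformSpace.Completion.norm_coe, UniformSpace.Completion.inner_coe]
  exact dissipation_le hf hg

theorem inner_reversalHilbert_of_mem {q q' : D.hilbert × D.hilbert}
    (hq : q ∈ closure D.preGraph) (hq' : q' ∈ closure D.preGraph) :
    inner ℝ (D.reversalHilbert q.2) q'.1 = inner ℝ (D.reversalHilbert q.1) q'.2 := by
  -- The relation involves two points of the graph, so the closure is taken in each of them in turn.
  refine D.closure_preGraph_subset (s := {q | inner ℝ (D.reversalHilbert q.2) q'.1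
    = inner ℝ (D.reversalHilbert q.1) q'.2}) (isClosed_eq (by fun_prop) (by fun_prop))
    (fun f g hf hg => ?_) hq
  refine D.closure_preGraph_subset (s := {q' | inner ℝ (D.reversalHilbert g) q'.1
    = inner ℝ (D.reversalHilbert f) q'.2}) (isClosed_eq (by fun_prop) (by fun_prop))
    (fun f' g' hf' hg' => ?_) hq'
  rw [Set.mem_ofPred_eq, reversalHilbert_coe, reversalHilbert_coe,
    UniformSpace.Completion.inner_coe, UniformSpace.Completion.inner_coe]
  exact inner_reversalLin_gen hf hg hf' hg'

theorem inner_powerLocal_of_mem {q : D.hilbert × D.hilbert} (hq : q ∈ closure D.preGraph) :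
    inner ℝ (D.powerLocal : D.hilbert) q.1 = -inner ℝ (D.kineticLocal : D.hilbert) q.2 := by
  refine D.closure_preGraph_subset (s := {q | inner ℝ (D.powerLocal : D.hilbert) q.1
    = -inner ℝ (D.kineticLocal : D.hilbert) q.2}) (isClosed_eq (by fun_prop) (by fun_prop))
    (fun f g hf hg => ?_) hq
  rw [Set.mem_ofPred_eq, UniformSpace.Completion.inner_coe, UniformSpace.Completion.inner_coe]
  exact inner_powerLocal hf hg

theorem reversalHilbert_current : D.reversalHilbert D.current = -D.current := by
  rw [current, reversalHilbert_coe, ← UniformSpace.Completion.coe_neg]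
  congr 1
  refine LocalFn.ext fun ω => ?_
  rw [reversalLin_fn, LocalFn.fn_neg]
  change D.currentFn (reversal ω) = -D.currentFn ω
  simp [currentFn, reversal]

theorem reversalHilbert_powerLocal :
    D.reversalHilbert D.powerLocal = -(D.powerLocal : D.hilbert) := by
  rw [reversalHilbert_coe, ← UniformSpace.Completion.coe_neg]
  congr 1
  refine LocalFn.ext fun ω => ?_
  rw [reversalLin_fn, LocalFn.fn_neg]
  change D.powerFn (reversal ω) = -D.powerFn ω
  simp [powerFn, reversal]

theorem reversalHilbert_kineticLocal :
    D.reversalHilbert D.kineticLocal = (D.kineticLocal : D.hilbert) := by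
  rw [reversalHilbert_coe]
  congr 1
  refine LocalFn.ext fun ω => ?_
  rw [reversalLin_fn]
  change kineticFn (reversal ω) = kineticFn ω
  simp [kineticFn, reversal]

theorem norm_symmCurrent_sq :
    ‖D.current + (1 / 2 : ℝ) • (D.powerLocal : D.hilbert)‖ ^ 2
      = D.T * Var[fun ω => deriv D.V (ω 0).1; D.gibbs] / 2 := by
  rw [current, ← UniformSpace.Completion.coe_smul, ← UniformSpace.Completion.coe_add,
    UniformSpace.Completion.norm_coe, ← real_inner_self_eq_norm_sq]
  exact D.inner_symmCurrent_self

end OscillatorChain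

end

/-! ### The Green–Kubo conductivity of the chain -/

theorem proposition6p1 (D : OscillatorChain) (P : C0Semigroup D.hilbert) (hP : D.IsDynamics P) :
    (∀ lam : ℝ, 0 < lam → Function.Bijective (resolventMap P.generator lam)) ∧
    Tendsto (D.greenKubo P) (𝓝[>] 0) (𝓝 (D.conductivity P)) ∧
    D.conductivity P ≤ Var[fun ω => deriv D.V (ω 0).1; D.gibbs] / (4 * D.γ * D.T) := by
  have hmem {u v : D.hilbert} (h : P.HasGen u v) : (u, v) ∈ closure D.preGraph := by
    rw [← show (P.generator.graph : Set (D.hilbert × D.hilbert)) = closure D.preGraph from hP]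
    exact P.mem_generator_graph_iff.2 h
  have hdiss (u v : D.hilbert) (h : P.HasGen u v) := D.dissipation_le_of_mem (hmem h)
  have hneg (u v : D.hilbert) (h : P.HasGen u v) : inner ℝ u v ≤ 0 := by
    have h1 := hdiss u v h
    have h2 : 0 ≤ D.γ / 2 * ‖u - D.reversalHilbert u‖ ^ 2 :=
      mul_nonneg (half_pos D.γ_pos).le (sq_nonneg _)
    linarith
  refine ⟨fun lam hlam => P.resolventMap_bijective hneg hlam, ?_⟩
  -- Here `φ` is the kinetic energy and `ψ` its time derivative.
  obtain ⟨l, hl, hle⟩ := C0Semigroup.exists_tendsto_inner_resolventApply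
    D.inner_reversalHilbert_left D.γ_pos hdiss
    (fun u v u' v' h h' => D.inner_reversalHilbert_of_mem (hmem h) (hmem h'))
    D.reversalHilbert_current D.reversalHilbert_kineticLocal D.reversalHilbert_powerLocal
    fun u v h => D.inner_powerLocal_of_mem (hmem h)
  have hGK : Tendsto (D.greenKubo P) (𝓝[>] 0) (𝓝 ((D.T ^ 2)⁻¹ * l)) := hl.const_mul _
  have hcond : D.conductivity P = (D.T ^ 2)⁻¹ * l := hGK.limUnder_eq
  rw [hcond]
  refine ⟨hGK, ?_⟩
  rw [D.norm_symmCurrent_sq] at hle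
  have hT := D.T_pos
  have hγ := D.γ_pos
  calc (D.T ^ 2)⁻¹ * l ≤ (D.T ^ 2)⁻¹ *
        (D.T * Var[fun ω => deriv D.V (ω 0).1; D.gibbs] / 2 / (2 * D.γ)) :=
        mul_le_mul_of_nonneg_left hle (by positivity)
    _ = _ := by
      field_simp
      ring
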